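/- Let $m\ge 1$ and $p\ge 0$ be integers and let $\Phi(z)$ be an $(m+p)\times(m+p)$ matrix of rational functions with complex coefficients that is a (discrete-time) spectral density, i.e. $\Phi$ has no poles on the unit circle and $\Phi(z)$ is Hermitian positive semidefinite for every $|z|=1$. Assume that $\Phi$ has rank $m$ over the field of rational functions. For a rational matrix $W$ write $W^*(z)=\overline{W(\bar z^{-1})}^{\top}$. A point $s$ of the Riemann sphere $\mathbb C\cup\{\infty\}$ is a pole of $W$ if it is a pole of some entry of $W$, and it is a zero of $W$ if it is not a pole of $W$ and $W(s)v=0$ for some nonzero constant vector $v$. The matrix $W$ is called minimum-phase if all its poles lie in the open unit disc $\{|z|<1\}$ and all its zeros lie in the closed unit disc $\{|z|\le 1\}$ (so that $\infty$ is neither a pole nor a zero). Then there exists an $(m+p)\times m$ rational matrix $W$ of full column rank $m$ that is minimum-phase and satisfies $\Phi=WW^*$. It is unique up to right multiplication by an arbitrary constant unitary matrix: if $W$ is one such matrix, then a rational $(m+p)\times m$ matrix $W'$ is another one if and only if $W'=WU$ for some constant unitary matrix $U\in\mathbb C^{m\times m}$. If moreover the entries of $\Phi$ have real coefficients, then $W$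 can be chosen with real coefficients. -/

import Mathlib

open scoped ComplexOrder

noncomputable section

namespace RatSpec

/-- The rational function `f(1/z)`. -/
def invSubst (f : RatFunc ℂ) : RatFunc ℂ :=
  RatFunc.eval RatFunc.C (RatFunc.X)⁻¹ f

/-- `f` has a pole at the point `s` of the Riemann sphere `ℂ ∪ {∞}`.  (`RatFunc.denom` is the
denominator in lowest terms; the point `∞` is moved to `0` by `z ↦ 1/z`.) -/
def HasPole (f : RatFunc ℂ) (s : OnePoint ℂ) : Prop :=
  s.elim ((invSubst f).denom.eval 0 = 0) (fun α => f.denom.eval α = 0)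

/-- The value of `f` at the point `s` of the Riemann sphere (meaningful when `s` is not a pole). -/
def value (f : RatFunc ℂ) (s : OnePoint ℂ) : ℂ :=
  s.elim (RatFunc.eval (RingHom.id ℂ) 0 (invSubst f)) (fun α => RatFunc.eval (RingHom.id ℂ) α f)

/-- The para-conjugate of a scalar rational function: the rational function
whose value at `z` is the complex conjugate of `f (1 / conj z)`, obtained by conjugating the
coefficients of `f` and substituting `1/z` for `z`. -/
def paraConj (f : RatFunc ℂ) : RatFunc ℂ :=
  RatFunc.eval ((RatFunc.C : ℂ →+* RatFunc ℂ).comp (starRingEnd ℂ)) (RatFunc.X)⁻¹ f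

/-- `f` is a quotient of two polynomials with real coefficients. -/
def HasRealCoeffs (f : RatFunc ℂ) : Prop :=
  ∃ P Q : Polynomial ℝ, Q ≠ 0 ∧
    f = algebraMap (Polynomial ℂ) (RatFunc ℂ) (P.map Complex.ofRealHom) /
        algebraMap (Polynomial ℂ) (RatFunc ℂ) (Q.map Complex.ofRealHom)

variable {ι κ : Type*}

/-- A pole of a rational matrix is a pole of one of its entries. -/
def MatHasPole (W : Matrix ι κ (RatFunc ℂ)) (s : OnePoint ℂ) : Prop :=
  ∃ i j, HasPole (W i j) s

/-- The value of a rational matrix at a point of the Riemann sphere. -/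
def matValue (W : Matrix ι κ (RatFunc ℂ)) (s : OnePoint ℂ) : Matrix ι κ ℂ :=
  W.map (fun f => value f s)

/-- A (right) zero of a rational matrix: a point `s` at which `W` is analytic and `W(s) v = 0` for
some nonzero vector `v`. -/
def MatHasZero [Fintype κ] (W : Matrix ι κ (RatFunc ℂ)) (s : OnePoint ℂ) : Prop :=
  ¬ MatHasPole W s ∧ ∃ v : κ → ℂ, v ≠ 0 ∧ (matValue W s).mulVec v = 0

/-- The para-Hermitian conjugate `W*(z)`, the conjugate transpose of `W (1 / conj z)`. -/
def matParaConj (W : Matrix ι κ (RatFunc ℂ)) : Matrix κ ι (RatFunc ℂ) :=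
  W.transpose.map paraConj

/-- A rational spectral density in discrete time: a square rational matrix that has no poles on the
unit circle and is Hermitian positive semidefinite at every point of the unit circle. -/
def IsSpectralDensity (Φ : Matrix ι ι (RatFunc ℂ)) : Prop :=
  ∀ z : ℂ, ‖z‖ = 1 → ¬ MatHasPole Φ (z : OnePoint ℂ) ∧ (matValue Φ (z : OnePoint ℂ)).PosSemidef

/-- Minimum phase in discrete time: all poles (on the Riemann sphere) lie in the open unit disc and
all zeros (on the Riemann sphere) lie in the closed unit disc. -/
def IsMinimumPhase [Fintype κ] (W : Matrix ι κ (RatFunc ℂ)) : Prop :=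
  (∀ s : OnePoint ℂ, MatHasPole W s → ∃ α : ℂ, s = (α : OnePoint ℂ) ∧ ‖α‖ < 1) ∧
  (∀ s : OnePoint ℂ, MatHasZero W s → ∃ α : ℂ, s = (α : OnePoint ℂ) ∧ ‖α‖ ≤ 1)

/-- `W` is a full-column-rank minimum-phase spectral factor of `Φ`: its columns are linearly
independent over the field of rational functions, `Φ = W W*`, and `W` is minimum phase. -/
def IsMinPhaseFactor [Fintype κ] (Φ : Matrix ι ι (RatFunc ℂ))
    (W : Matrix ι κ (RatFunc ℂ)) : Prop :=
  W.rank = Fintype.card κ ∧ Φ = W * matParaConj W ∧ IsMinimumPhase W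

end RatSpec

end

/-! The substitution `z ↦ 1/z` turns minimum-phase factors of `Φ` into outer factors of `Φ(1/z)`:
analytic on the closed unit disc and injective at every point of the open disc
(`isMinPhaseFactor_iff`). Everything is proved for outer factors and carried back.

Uniqueness (`IsOuterFactor.unique`): two outer factors satisfy `W' = W T` with `T T* = 1`.
Injectivity of `W` excludes poles of `T` in the open disc, `T T* = 1` excludes them on the circle,
and the same holds for `T*`. Reflection in the circle then leaves `T` without poles on the sphere,
so `T` is a constant unitary matrix.

Existence (`exists_outerFactor`): symmetric elimination, with the scalar Fejér–Riesz theorem applied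
to each pivot, gives some `W` with `m` columns and `Φ = W W*` (`exists_eq_mul_conjTranspose`). A
scalar Blaschke product removes the poles in the disc (`exists_allPass`); poles on the circle cannot
occur because `Φ` has none there. Zeros in the disc are pushed out one at a time by para-unitary
matrices (`exists_zero_removal`), and the zeros of a fixed maximal minor in the disc bound the
number of steps.

Real coefficients (`IsOuterFactor.exists_real`): if `Φ` is real, the conjugate of `W` is again
outer, hence equals `W U` with `U` unitary. Making an invertible block of `W(0)` real forces `U =
1`. -/

noncomputable section

namespace RatSpec

/-! ### Regular points and values of scalar rational functions -/

/-- The rational function `f` is analytic at the point `s` of the complex plane. -/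
def Reg (s : ℂ) (f : RatFunc ℂ) : Prop := f.denom.eval s ≠ 0

/-- The value of a rational function at a point of the complex plane. -/
def val (s : ℂ) (f : RatFunc ℂ) : ℂ := RatFunc.eval (RingHom.id ℂ) s f

section Scalar

variable {s : ℂ} {f g : RatFunc ℂ}

theorem Reg.eval₂_ne_zero (hf : Reg s f) :
    Polynomial.eval₂ (RingHom.id ℂ) s f.denom ≠ 0 := by
  simpa [Reg, Polynomial.eval₂_id] using hf

theorem val_add (hf : Reg s f) (hg : Reg s g) : val s (f + g) = val s f + val s g :=
  RatFunc.eval_add _ _ hf.eval₂_ne_zero hg.eval₂_ne_zero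

theorem val_mul (hf : Reg s f) (hg : Reg s g) : val s (f * g) = val s f * val s g :=
  RatFunc.eval_mul _ _ hf.eval₂_ne_zero hg.eval₂_ne_zero

theorem reg_of_denom_dvd {q : Polynomial ℂ} (h : f.denom ∣ q) (hq : q.eval s ≠ 0) : Reg s f := by
  obtain ⟨r, rfl⟩ := h
  intro h0
  exact hq (by simp [h0])

theorem Reg.add (hf : Reg s f) (hg : Reg s g) : Reg s (f + g) :=
  reg_of_denom_dvd (RatFunc.denom_add_dvd f g) (by
    rw [Polynomial.eval_mul]; exact mul_ne_zero hf hg)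

theorem Reg.mul (hf : Reg s f) (hg : Reg s g) : Reg s (f * g) :=
  reg_of_denom_dvd (RatFunc.denom_mul_dvd f g) (by
    rw [Polynomial.eval_mul]; exact mul_ne_zero hf hg)

@[simp] theorem reg_algebraMap (s : ℂ) (P : Polynomial ℂ) :
    Reg s (algebraMap (Polynomial ℂ) (RatFunc ℂ) P) := by
  simp [Reg]

@[simp] theorem reg_C (s a : ℂ) : Reg s (RatFunc.C a) := by simp [Reg]

@[simp] theorem reg_X (s : ℂ) : Reg s RatFunc.X := by simp [Reg]

@[simp] theorem reg_zero (s : ℂ) : Reg s 0 := by simp [Reg]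

@[simp] theorem reg_one (s : ℂ) : Reg s 1 := by simp [Reg]

@[simp] theorem val_algebraMap (s : ℂ) (P : Polynomial ℂ) :
    val s (algebraMap (Polynomial ℂ) (RatFunc ℂ) P) = P.eval s := by
  simp [val, RatFunc.eval, Polynomial.eval₂_id]

@[simp] theorem val_C (s a : ℂ) : val s (RatFunc.C a) = a := by simp [val]

@[simp] theorem val_X (s : ℂ) : val s RatFunc.X = s := by simp [val]

@[simp] theorem val_zero (s : ℂ) : val s 0 = 0 := by simp [val]

@[simp] theorem val_one (s : ℂ) : val s 1 = 1 := by simp [val]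

theorem Reg.neg (hf : Reg s f) : Reg s (-f) := by
  have := (reg_C s (-1)).mul hf
  simpa using this

theorem val_neg (hf : Reg s f) : val s (-f) = -val s f := by
  have := val_mul (reg_C s (-1)) hf
  rw [val_C] at this
  simpa using this

theorem Reg.sub (hf : Reg s f) (hg : Reg s g) : Reg s (f - g) := by
  rw [sub_eq_add_neg]; exact hf.add hg.neg

theorem val_sub (hf : Reg s f) (hg : Reg s g) : val s (f - g) = val s f - val s g := by
  rw [sub_eq_add_neg, val_add hf hg.neg, val_neg hg, sub_eq_add_neg]

theorem Reg.pow (hf : Reg s f) (n : ℕ) : Reg s (f ^ n) := by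
  induction n with
  | zero => simp
  | succ n ih => rw [pow_succ]; exact ih.mul hf

theorem val_pow (hf : Reg s f) (n : ℕ) : val s (f ^ n) = val s f ^ n := by
  induction n with
  | zero => simp
  | succ n ih => rw [pow_succ, val_mul (hf.pow n) hf, ih, pow_succ]

theorem reg_sum {ι : Type*} {t : Finset ι} {F : ι → RatFunc ℂ} (h : ∀ i ∈ t, Reg s (F i)) :
    Reg s (∑ i ∈ t, F i) := by
  classical
  induction t using Finset.induction_on with
  | empty => simp
  | insert a t ha ih =>
    rw [Finset.sum_insert ha]
    exact (h a (Finset.mem_insert_self _ _)).add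
      (ih fun i hi => h i (Finset.mem_insert_of_mem hi))

theorem val_sum {ι : Type*} {t : Finset ι} {F : ι → RatFunc ℂ} (h : ∀ i ∈ t, Reg s (F i)) :
    val s (∑ i ∈ t, F i) = ∑ i ∈ t, val s (F i) := by
  classical
  induction t using Finset.induction_on with
  | empty => simp
  | insert a t ha ih =>
    have h' : ∀ i ∈ t, Reg s (F i) := fun i hi => h i (Finset.mem_insert_of_mem hi)
    rw [Finset.sum_insert ha, Finset.sum_insert ha,
      val_add (h a (Finset.mem_insert_self _ _)) (reg_sum h'), ih h']

theorem val_eq_div (s : ℂ) (f : RatFunc ℂ) : val s f = f.num.eval s / f.denom.eval s := by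
  simp [val, RatFunc.eval, Polynomial.eval₂_id]

theorem Reg.inv (hf : Reg s f) (h : val s f ≠ 0) : Reg s f⁻¹ := by
  have hf0 : f ≠ 0 := by rintro rfl; simp at h
  refine reg_of_denom_dvd (RatFunc.denom_inv_dvd hf0) ?_
  intro h0
  exact h (by rw [val_eq_div, h0, zero_div])

theorem val_inv (hf : Reg s f) (h : val s f ≠ 0) : val s f⁻¹ = (val s f)⁻¹ := by
  have hf0 : f ≠ 0 := by rintro rfl; simp at h
  have := val_mul hf (hf.inv h)
  rw [mul_inv_cancel₀ hf0, val_one] at this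
  exact eq_inv_of_mul_eq_one_right this.symm

theorem Reg.div (hf : Reg s f) (hg : Reg s g) (h : val s g ≠ 0) : Reg s (f / g) := by
  rw [div_eq_mul_inv]; exact hf.mul (hg.inv h)

theorem val_div (hf : Reg s f) (hg : Reg s g) (h : val s g ≠ 0) :
    val s (f / g) = val s f / val s g := by
  rw [div_eq_mul_inv, val_mul hf (hg.inv h), val_inv hg h, div_eq_mul_inv]

theorem Reg.zpow (hf : Reg s f) (h : val s f ≠ 0) (n : ℤ) : Reg s (f ^ n) := by
  cases n with
  | ofNat n => simpa using hf.pow n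
  | negSucc n =>
    rw [zpow_negSucc]
    exact (hf.pow _).inv (by rw [val_pow hf]; exact pow_ne_zero _ h)

theorem val_zpow (hf : Reg s f) (h : val s f ≠ 0) (n : ℤ) : val s (f ^ n) = val s f ^ n := by
  cases n with
  | ofNat n => simpa using val_pow hf n
  | negSucc n =>
    rw [zpow_negSucc, val_inv (hf.pow _) (by rw [val_pow hf]; exact pow_ne_zero _ h),
      val_pow hf, zpow_negSucc]

/-- Polynomial representation of an analytic rational function. -/
theorem Reg.exists_div (hf : Reg s f) : ∃ p q : Polynomial ℂ, q.eval s ≠ 0 ∧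
    f = algebraMap (Polynomial ℂ) (RatFunc ℂ) p / algebraMap (Polynomial ℂ) (RatFunc ℂ) q :=
  ⟨f.num, f.denom, hf, (RatFunc.num_div_denom f).symm⟩

theorem reg_div_X_sub_C (hf : Reg s f) (h : val s f = 0) :
    Reg s (f / (RatFunc.X - RatFunc.C s)) := by
  obtain ⟨p, q, hq, rfl⟩ := hf.exists_div
  rw [val_div (by simp) (by simp) (by simpa using hq)] at h
  have hp : p.eval s = 0 := by
    simpa [hq] using h
  obtain ⟨r, rfl⟩ := Polynomial.dvd_iff_isRoot.mpr hp
  have e : (algebraMap (Polynomial ℂ) (RatFunc ℂ) (Polynomial.X - Polynomial.C s)) =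
      RatFunc.X - RatFunc.C s := by simp
  have e0 : (RatFunc.X - RatFunc.C s : RatFunc ℂ) ≠ 0 := by
    rw [← e]; exact RatFunc.algebraMap_ne_zero (Polynomial.X_sub_C_ne_zero s)
  have : algebraMap (Polynomial ℂ) (RatFunc ℂ) ((Polynomial.X - Polynomial.C s) * r) /
      algebraMap (Polynomial ℂ) (RatFunc ℂ) q / (RatFunc.X - RatFunc.C s) =
      algebraMap (Polynomial ℂ) (RatFunc ℂ) r / algebraMap (Polynomial ℂ) (RatFunc ℂ) q := by
    rw [map_mul, e]
    field_simp
  rw [this]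
  exact (reg_algebraMap s r).div (reg_algebraMap s q) (by simpa using hq)

theorem X_sub_C_ne_zero (s : ℂ) : (RatFunc.X - RatFunc.C s : RatFunc ℂ) ≠ 0 := by
  have e : (algebraMap (Polynomial ℂ) (RatFunc ℂ) (Polynomial.X - Polynomial.C s)) =
      RatFunc.X - RatFunc.C s := by simp
  rw [← e]; exact RatFunc.algebraMap_ne_zero (Polynomial.X_sub_C_ne_zero s)

theorem reg_X_sub_C (s a : ℂ) : Reg s (RatFunc.X - RatFunc.C a) := (reg_X s).sub (reg_C s a)

theorem val_X_sub_C (s a : ℂ) : val s (RatFunc.X - RatFunc.C a) = s - a := by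
  rw [val_sub (reg_X s) (reg_C s a), val_X, val_C]

theorem finite_not_reg (f : RatFunc ℂ) : {s | ¬ Reg s f}.Finite := by
  have : {s | ¬ Reg s f} = {s | f.denom.IsRoot s} := by
    ext s; simp [Reg, Polynomial.IsRoot]
  rw [this]
  exact Polynomial.finite_setOfPred_isRoot f.denom_ne_zero

theorem finite_val_eq_zero (hf : f ≠ 0) : {s | val s f = 0}.Finite := by
  refine ((finite_not_reg f).union (Polynomial.finite_setOfPred_isRoot (RatFunc.num_ne_zero hf))).subset
    fun s hs => ?_
  simp only [Set.mem_union, Set.mem_ofPred_eq, Polynomial.IsRoot] at hs ⊢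
  by_contra! h
  rw [val_eq_div, div_eq_zero_iff] at hs
  exact hs.elim h.2 h.1

end Scalar

/-! ### The substitutions `z ↦ 1/z` and conjugation of the coefficients -/

theorem ratFunc_ringHom_ext {φ ψ : RatFunc ℂ →+* RatFunc ℂ}
    (hC : ∀ a, φ (RatFunc.C a) = ψ (RatFunc.C a)) (hX : φ RatFunc.X = ψ RatFunc.X) : φ = ψ := by
  refine IsLocalization.ringHom_ext (nonZeroDivisors (Polynomial ℂ)) ?_
  refine Polynomial.ringHom_ext (fun a => ?_) ?_
  · simpa using hC a
  · simpa using hX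

theorem X_inv_transcendental : Transcendental ℂ (RatFunc.X : RatFunc ℂ)⁻¹ := by
  intro h
  exact RatFunc.transcendental_X (K := ℂ) (by simpa using h.inv)

/-- This is what allows the substitution `z ↦ 1/z` to extend from polynomials to their fraction
field. -/
theorem eval₂_C_X_inv_ne_zero {p : Polynomial ℂ} (hp : p ≠ 0) :
    p.eval₂ RatFunc.C (RatFunc.X : RatFunc ℂ)⁻¹ ≠ 0 := by
  intro h
  exact X_inv_transcendental ⟨p, hp, by simpa [Polynomial.aeval_def] using h⟩

/-- The substitution `z ↦ 1/z` as a ring homomorphism. -/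
def invHom : RatFunc ℂ →+* RatFunc ℂ :=
  RatFunc.liftRingHom (Polynomial.eval₂RingHom RatFunc.C (RatFunc.X)⁻¹) fun p hp => by
    simpa using eval₂_C_X_inv_ne_zero (nonZeroDivisors.ne_zero hp)

/-- Conjugation of the coefficients as a ring homomorphism. -/
def conjHom : RatFunc ℂ →+* RatFunc ℂ :=
  RatFunc.liftRingHom ((algebraMap (Polynomial ℂ) (RatFunc ℂ)).comp
    (Polynomial.mapRingHom (starRingEnd ℂ))) fun p hp => by
    simpa [Polynomial.map_eq_zero] using nonZeroDivisors.ne_zero hp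

@[simp] theorem invHom_C (a : ℂ) : invHom (RatFunc.C a) = RatFunc.C a := by
  rw [← RatFunc.algebraMap_C, invHom, RatFunc.liftRingHom_algebraMap]; simp

@[simp] theorem invHom_X : invHom RatFunc.X = RatFunc.X⁻¹ := by
  rw [← RatFunc.algebraMap_X, invHom, RatFunc.liftRingHom_algebraMap]; simp

@[simp] theorem conjHom_C (a : ℂ) : conjHom (RatFunc.C a) = RatFunc.C (starRingEnd ℂ a) := by
  rw [← RatFunc.algebraMap_C, conjHom, RatFunc.liftRingHom_algebraMap]; simp

@[simp] theorem conjHom_X : conjHom RatFunc.X = RatFunc.X := by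
  rw [← RatFunc.algebraMap_X, conjHom, RatFunc.liftRingHom_algebraMap]; simp

theorem conjHom_algebraMap (p : Polynomial ℂ) :
    conjHom (algebraMap (Polynomial ℂ) (RatFunc ℂ) p) =
      algebraMap (Polynomial ℂ) (RatFunc ℂ) (p.map (starRingEnd ℂ)) := by
  rw [conjHom, RatFunc.liftRingHom_algebraMap]; simp

theorem invSubst_eq (f : RatFunc ℂ) : invSubst f = invHom f := by
  rw [invHom, RatFunc.liftRingHom_apply]; rfl

theorem invHom_algebraMap (p : Polynomial ℂ) :
    invHom (algebraMap (Polynomial ℂ) (RatFunc ℂ) p) = p.eval₂ RatFunc.C (RatFunc.X)⁻¹ := by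
  rw [invHom, RatFunc.liftRingHom_algebraMap]; rfl

theorem paraConj_eq (f : RatFunc ℂ) : paraConj f = invHom (conjHom f) := by
  rw [conjHom, RatFunc.liftRingHom_apply, map_div₀]
  simp only [RingHom.comp_apply, Polynomial.coe_mapRingHom, invHom_algebraMap,
    Polynomial.eval₂_map]
  rfl

@[simp] theorem invHom_invHom (f : RatFunc ℂ) : invHom (invHom f) = f := by
  have : invHom.comp invHom = RingHom.id _ := ratFunc_ringHom_ext (by simp) (by simp)
  exact congrArg (fun φ => φ f) this

@[simp] theorem conjHom_conjHom (f : RatFunc ℂ) : conjHom (conjHom f) = f := by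
  have : conjHom.comp conjHom = RingHom.id _ := ratFunc_ringHom_ext (by simp) (by simp)
  exact congrArg (fun φ => φ f) this

theorem conjHom_invHom (f : RatFunc ℂ) : conjHom (invHom f) = invHom (conjHom f) := by
  have : conjHom.comp invHom = invHom.comp conjHom := ratFunc_ringHom_ext (by simp) (by simp)
  exact congrArg (fun φ => φ f) this

/-- The involution `f ↦ f*` of the field of rational functions. -/
instance paraStarRing : StarRing (RatFunc ℂ) where
  star := paraConj
  star_involutive f := by
    rw [paraConj_eq, paraConj_eq, conjHom_invHom, invHom_invHom, conjHom_conjHom]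
  star_mul f g := by
    change paraConj (f * g) = paraConj g * paraConj f
    rw [paraConj_eq, paraConj_eq, paraConj_eq, map_mul, map_mul, mul_comm]
  star_add f g := by
    change paraConj (f + g) = paraConj f + paraConj g
    rw [paraConj_eq, paraConj_eq, paraConj_eq, map_add, map_add]

theorem star_eq (f : RatFunc ℂ) : star f = invHom (conjHom f) := paraConj_eq f

@[simp] theorem star_C (a : ℂ) : star (RatFunc.C a) = RatFunc.C (starRingEnd ℂ a) := by
  rw [star_eq]; simp

@[simp] theorem star_X : star (RatFunc.X : RatFunc ℂ) = RatFunc.X⁻¹ := by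
  rw [star_eq]; simp

theorem matParaConj_eq {ι κ : Type*} (W : Matrix ι κ (RatFunc ℂ)) :
    matParaConj W = W.conjTranspose := rfl

section Substitution

variable {s : ℂ} {f : RatFunc ℂ}

theorem Reg.invHom_and_val (hs : s ≠ 0) (hf : Reg s f) :
    Reg s⁻¹ (invHom f) ∧ val s⁻¹ (invHom f) = val s f := by
  have hX : Reg s⁻¹ (RatFunc.X : RatFunc ℂ)⁻¹ := (reg_X _).inv (by simpa using hs)
  have hXv : val s⁻¹ (RatFunc.X : RatFunc ℂ)⁻¹ = s := by
    rw [val_inv (reg_X _) (by simpa using hs)]; simp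
  have key : ∀ p : Polynomial ℂ,
      Reg s⁻¹ (invHom (algebraMap (Polynomial ℂ) (RatFunc ℂ) p)) ∧
      val s⁻¹ (invHom (algebraMap (Polynomial ℂ) (RatFunc ℂ) p)) = p.eval s := by
    intro p
    induction p using Polynomial.induction_on' with
    | add p q hp hq =>
      rw [map_add, map_add]
      exact ⟨hp.1.add hq.1, by rw [val_add hp.1 hq.1, hp.2, hq.2, Polynomial.eval_add]⟩
    | monomial n a =>
      rw [RatFunc.algebraMap_monomial, map_mul, map_pow, invHom_C, invHom_X]
      refine ⟨(reg_C _ _).mul (hX.pow n), ?_⟩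
      rw [val_mul (reg_C _ _) (hX.pow n), val_pow hX, hXv]
      simp
  obtain ⟨p, q, hq, rfl⟩ := hf.exists_div
  rw [map_div₀]
  have h0 : val s⁻¹ (invHom (algebraMap (Polynomial ℂ) (RatFunc ℂ) q)) ≠ 0 := by
    rw [(key q).2]; exact hq
  refine ⟨(key p).1.div (key q).1 h0, ?_⟩
  rw [val_div (key p).1 (key q).1 h0, (key p).2, (key q).2,
    val_div (by simp) (by simp) (by simpa using hq)]
  simp

theorem Reg.conjHom_and_val (hf : Reg s f) :
    Reg (starRingEnd ℂ s) (conjHom f) ∧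
      val (starRingEnd ℂ s) (conjHom f) = starRingEnd ℂ (val s f) := by
  have key : ∀ p : Polynomial ℂ, (p.map (starRingEnd ℂ)).eval (starRingEnd ℂ s) =
      starRingEnd ℂ (p.eval s) := fun p => by
    rw [Polynomial.eval_map, Polynomial.eval₂_at_apply]
  obtain ⟨p, q, hq, rfl⟩ := hf.exists_div
  rw [map_div₀, conjHom_algebraMap, conjHom_algebraMap]
  have h0 : val (starRingEnd ℂ s)
      (algebraMap (Polynomial ℂ) (RatFunc ℂ) (q.map (starRingEnd ℂ))) ≠ 0 := by
    rw [val_algebraMap, key]; simpa using hq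
  refine ⟨(reg_algebraMap _ _).div (reg_algebraMap _ _) h0, ?_⟩
  rw [val_div (by simp) (by simp) h0, val_div (by simp) (by simp) (by simpa using hq)]
  simp [key]

/-- The involution transports behaviour at `s` to the reflection of `s` in the unit circle. Points
of the circle are fixed, so there `star` is pointwise conjugation. -/
theorem Reg.star_and_val (hs : s ≠ 0) (hf : Reg s f) :
    Reg (starRingEnd ℂ s)⁻¹ (star f) ∧
      val (starRingEnd ℂ s)⁻¹ (star f) = starRingEnd ℂ (val s f) := by
  rw [star_eq]
  have h := hf.conjHom_and_val
  have h' := h.1.invHom_and_val (by simpa using hs)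
  exact ⟨h'.1, h'.2.trans h.2⟩

theorem conj_inv_of_norm_eq_one (hs : ‖s‖ = 1) : (starRingEnd ℂ s)⁻¹ = s := by
  rw [← Complex.inv_eq_conj hs, inv_inv]

theorem ne_zero_of_norm_eq_one (hs : ‖s‖ = 1) : s ≠ 0 := by
  rintro rfl; simp at hs

theorem Reg.star_of_norm_eq_one (hs : ‖s‖ = 1) (hf : Reg s f) : Reg s (star f) := by
  simpa [conj_inv_of_norm_eq_one hs] using (hf.star_and_val (ne_zero_of_norm_eq_one hs)).1

theorem val_star_of_norm_eq_one (hs : ‖s‖ = 1) (hf : Reg s f) :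
    val s (star f) = starRingEnd ℂ (val s f) := by
  simpa [conj_inv_of_norm_eq_one hs] using (hf.star_and_val (ne_zero_of_norm_eq_one hs)).2

theorem X_pow_mul_invHom (p : Polynomial ℂ) :
    RatFunc.X ^ p.natDegree * invHom (algebraMap (Polynomial ℂ) (RatFunc ℂ) p) =
      algebraMap (Polynomial ℂ) (RatFunc ℂ) p.reverse := by
  rw [invHom_algebraMap]
  let _ : Invertible (RatFunc.X : RatFunc ℂ)⁻¹ :=
    ⟨RatFunc.X, mul_inv_cancel₀ RatFunc.X_ne_zero, inv_mul_cancel₀ RatFunc.X_ne_zero⟩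
  have := Polynomial.eval₂_reverse_mul_pow RatFunc.C (RatFunc.X : RatFunc ℂ)⁻¹ p
  have e : Polynomial.eval₂ RatFunc.C (RatFunc.X : RatFunc ℂ) p.reverse =
      algebraMap (Polynomial ℂ) (RatFunc ℂ) p.reverse := by
    rw [← RatFunc.aeval_X_left_eq_algebraMap, Polynomial.aeval_def]
    rfl
  rw [← this, ← e, inv_pow, mul_comm, mul_assoc, inv_mul_cancel₀ (pow_ne_zero _ RatFunc.X_ne_zero), mul_one]
  rfl

/-- A rational function that is analytic on the whole Riemann sphere is constant. -/
theorem eq_C_of_reg (h : ∀ s, Reg s f) (h0 : Reg 0 (invHom f)) : ∃ a, f = RatFunc.C a := by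
  have hd : f.denom.natDegree = 0 := by
    by_contra hne
    obtain ⟨s, hs⟩ := IsAlgClosed.exists_root f.denom (by
      intro h; exact hne (Polynomial.natDegree_eq_of_degree_eq_some h))
    exact h s hs
  have hd1 : f.denom = 1 := f.monic_denom.natDegree_eq_zero.mp hd
  have hf : f = algebraMap (Polynomial ℂ) (RatFunc ℂ) f.num := by
    conv_lhs => rw [← RatFunc.num_div_denom f, hd1]
    simp
  generalize f.num = p at hf
  subst hf
  by_cases hp : p.natDegree = 0
  · obtain ⟨a, rfl⟩ := Polynomial.natDegree_eq_zero.mp hp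
    exact ⟨a, by simp⟩
  exfalso
  -- At `0` the left side vanishes, since the degree is positive and `p(1/z)` is regular there; the
  -- right side is the leading coefficient of `p`.
  have hrev := X_pow_mul_invHom p
  have := congrArg (val 0) hrev
  rw [val_mul ((reg_X 0).pow _) h0, val_pow (reg_X 0), val_X, zero_pow hp, zero_mul,
    val_algebraMap] at this
  have h2 : p.reverse.eval 0 = p.leadingCoeff := by
    rw [← Polynomial.coeff_zero_eq_eval_zero, Polynomial.coeff_zero_reverse]
  rw [h2] at this
  exact hp (by rw [Polynomial.leadingCoeff_eq_zero.mp this.symm]; simp)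

end Substitution

/-! ### Rational matrices: regularity, values and poles -/

section Matrices

variable {ι κ μ : Type*} {s : ℂ}

/-- The rational matrix `W` is analytic at the point `s` of the complex plane. -/
def MReg (s : ℂ) (W : Matrix ι κ (RatFunc ℂ)) : Prop := ∀ i j, Reg s (W i j)

/-- The value of a rational matrix at a point of the complex plane. -/
def mval (s : ℂ) (W : Matrix ι κ (RatFunc ℂ)) : Matrix ι κ ℂ := W.map (val s)

theorem MReg.mul [Fintype κ] {A : Matrix ι κ (RatFunc ℂ)} {B : Matrix κ μ (RatFunc ℂ)}
    (hA : MReg s A) (hB : MReg s B) : MReg s (A * B) := fun i j => by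
  rw [Matrix.mul_apply]
  exact reg_sum fun k _ => (hA i k).mul (hB k j)

theorem mval_mul [Fintype κ] {A : Matrix ι κ (RatFunc ℂ)} {B : Matrix κ μ (RatFunc ℂ)}
    (hA : MReg s A) (hB : MReg s B) : mval s (A * B) = mval s A * mval s B := by
  ext i j
  simp only [mval, Matrix.map_apply, Matrix.mul_apply]
  rw [val_sum fun k _ => (hA i k).mul (hB k j)]
  exact Finset.sum_congr rfl fun k _ => val_mul (hA i k) (hB k j)

theorem MReg.add {A B : Matrix ι κ (RatFunc ℂ)} (hA : MReg s A) (hB : MReg s B) :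
    MReg s (A + B) := fun i j => (hA i j).add (hB i j)

theorem MReg.smul {A : Matrix ι κ (RatFunc ℂ)} {f : RatFunc ℂ} (hf : Reg s f) (hA : MReg s A) :
    MReg s (f • A) := fun i j => hf.mul (hA i j)

theorem mval_smul {A : Matrix ι κ (RatFunc ℂ)} {f : RatFunc ℂ} (hf : Reg s f) (hA : MReg s A) :
    mval s (f • A) = val s f • mval s A := by
  ext i j
  exact val_mul hf (hA i j)

theorem mReg_map_C (s : ℂ) (A : Matrix ι κ ℂ) : MReg s (A.map RatFunc.C) := fun _ _ => reg_C _ _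

@[simp] theorem mval_map_C (s : ℂ) (A : Matrix ι κ ℂ) : mval s (A.map RatFunc.C) = A := by
  ext i j; simp [mval]

theorem mReg_one [DecidableEq ι] (s : ℂ) : MReg s (1 : Matrix ι ι (RatFunc ℂ)) := fun i j => by
  by_cases h : i = j
  · subst h; simp
  · simp [Matrix.one_apply_ne h]

theorem MReg.conjTranspose (hs : ‖s‖ = 1) {A : Matrix ι κ (RatFunc ℂ)} (hA : MReg s A) :
    MReg s A.conjTranspose := fun i j => (hA j i).star_of_norm_eq_one hs

theorem mval_conjTranspose (hs : ‖s‖ = 1) {A : Matrix ι κ (RatFunc ℂ)} (hA : MReg s A) :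
    mval s A.conjTranspose = (mval s A).conjTranspose := by
  ext i j
  exact val_star_of_norm_eq_one hs (hA j i)

theorem exists_reg_pow_mul (s : ℂ) (f : RatFunc ℂ) :
    ∃ k : ℕ, Reg s ((RatFunc.X - RatFunc.C s) ^ k * f) := by
  obtain ⟨q, hq, hqs⟩ := Polynomial.exists_eq_pow_rootMultiplicity_mul_and_not_dvd f.denom
    f.denom_ne_zero s
  set k := f.denom.rootMultiplicity s
  refine ⟨k, ?_⟩
  have hq0 : q.eval s ≠ 0 := fun h => hqs (Polynomial.dvd_iff_isRoot.mpr h)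
  have e : (RatFunc.X - RatFunc.C s) ^ k * f =
      algebraMap (Polynomial ℂ) (RatFunc ℂ) f.num / algebraMap (Polynomial ℂ) (RatFunc ℂ) q := by
    conv_lhs => rw [← RatFunc.num_div_denom f, hq]
    have h1 := X_sub_C_ne_zero s
    simp only [map_mul, map_pow, map_sub, RatFunc.algebraMap_X, RatFunc.algebraMap_C]
    field_simp
  rw [e]
  exact (reg_algebraMap _ _).div (reg_algebraMap _ _) (by simpa using hq0)

/-- At a pole, multiplication by a suitable power of the local parameter gives a matrix that is
analytic and nonzero. -/
theorem exists_pow_smul_of_not_mReg [Finite ι] [Finite κ] {T : Matrix ι κ (RatFunc ℂ)}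
    (hT : ¬ MReg s T) : ∃ k : ℕ, 1 ≤ k ∧ MReg s ((RatFunc.X - RatFunc.C s) ^ k • T) ∧
      mval s ((RatFunc.X - RatFunc.C s) ^ k • T) ≠ 0 := by
  classical
  have := Fintype.ofFinite ι
  have := Fintype.ofFinite κ
  have hex : ∃ k : ℕ, MReg s ((RatFunc.X - RatFunc.C s) ^ k • T) := by
    choose k hk using fun i j => exists_reg_pow_mul s (T i j)
    refine ⟨∑ i, ∑ j, k i j, fun i j => ?_⟩
    have hle : k i j ≤ ∑ i, ∑ j, k i j :=
      (Finset.single_le_sum (f := k i) (fun _ _ => Nat.zero_le _) (Finset.mem_univ j)).trans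
        (Finset.single_le_sum (f := fun i => ∑ j, k i j) (fun _ _ => Nat.zero_le _)
          (Finset.mem_univ i))
    obtain ⟨l, hl⟩ := Nat.exists_eq_add_of_le hle
    rw [Matrix.smul_apply, smul_eq_mul, hl, pow_add, mul_comm (_ ^ k i j), mul_assoc]
    exact ((reg_X_sub_C s s).pow l).mul (hk i j)
  have hpos : 1 ≤ Nat.find hex := by
    rw [Nat.one_le_iff_ne_zero]
    intro h0
    have := Nat.find_spec hex
    rw [h0] at this
    exact hT (by simpa using this)
  refine ⟨Nat.find hex, hpos, Nat.find_spec hex, fun h0 => ?_⟩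
  have hspec := Nat.find_spec hex
  obtain ⟨k, hk⟩ := Nat.exists_eq_add_of_le' hpos
  rw [hk] at h0 hspec
  -- If the value at `s` were zero, every entry would be divisible by `X - C s` and the exponent `k`
  -- would already suffice.
  refine Nat.find_min hex (m := k) (by omega) fun i j => ?_
  have h1 := reg_div_X_sub_C (hspec i j) (congrFun (congrFun h0 i) j)
  rw [Matrix.smul_apply, smul_eq_mul, pow_succ, mul_right_comm,
    mul_div_cancel_right₀ _ (X_sub_C_ne_zero s)] at h1
  exact h1

/-- If `T T*` has no pole at a point of the unit circle, neither has `T`. -/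
theorem mReg_of_mul_conjTranspose [Finite ι] [Fintype κ] (hs : ‖s‖ = 1)
    {T : Matrix ι κ (RatFunc ℂ)} (h : MReg s (T * T.conjTranspose)) : MReg s T := by
  by_contra hT
  obtain ⟨k, hk, hreg, hne⟩ := exists_pow_smul_of_not_mReg hT
  set g : RatFunc ℂ := (RatFunc.X - RatFunc.C s) ^ k with hg
  have hgr : Reg s g := (reg_X_sub_C s s).pow k
  have hgv : val s g = 0 := by
    rw [val_pow (reg_X_sub_C s s), val_X_sub_C, sub_self, zero_pow (by omega)]
  apply hne
  -- The right side vanishes at `s` with `g`, so the value `A` of `g • T` there satisfies `A A* =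
  -- 0`, whence `A = 0`.
  have e : (g • T) * (g • T).conjTranspose = g • star g • (T * T.conjTranspose) := by
    rw [Matrix.conjTranspose_smul, Matrix.smul_mul, Matrix.mul_smul]
  have e2 := congrArg (mval s) e
  have hr2 : MReg s (star g • (T * T.conjTranspose)) := h.smul (hgr.star_of_norm_eq_one hs)
  rw [mval_mul hreg (hreg.conjTranspose hs), mval_conjTranspose hs hreg, mval_smul hgr hr2, hgv,
    zero_smul] at e2
  exact Matrix.self_mul_conjTranspose_eq_zero.mp e2

/-- `W T = W'` with `W, W'` analytic at `s` and `W(s)` injective forces `T` to be analytic at `s`. -/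
theorem mReg_of_mul_eq [Fintype κ] [Finite μ] {W : Matrix ι κ (RatFunc ℂ)}
    {T : Matrix κ μ (RatFunc ℂ)} (hW : MReg s W)
    (hinj : ∀ v, (mval s W).mulVec v = 0 → v = 0) (hWT : MReg s (W * T)) : MReg s T := by
  by_contra hT
  obtain ⟨k, hk, hreg, hne⟩ := exists_pow_smul_of_not_mReg hT
  set g : RatFunc ℂ := (RatFunc.X - RatFunc.C s) ^ k with hg
  have hgr : Reg s g := (reg_X_sub_C s s).pow k
  have hgv : val s g = 0 := by
    rw [val_pow (reg_X_sub_C s s), val_X_sub_C, sub_self, zero_pow (by omega)]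
  have e2 : mval s W * mval s (g • T) = 0 := by
    rw [← mval_mul hW hreg, Matrix.mul_smul, mval_smul hgr hWT, hgv, zero_smul]
  apply hne
  ext i j
  have := hinj (fun i => mval s (g • T) i j) (by
    ext a
    exact congrFun (congrFun e2 a) j)
  exact congrFun this i

theorem map_C_conjTranspose (U : Matrix ι κ ℂ) :
    (U.map RatFunc.C).conjTranspose = U.conjTranspose.map RatFunc.C := by
  ext i j; simp

end Matrices

/-! ### Uniqueness of the spectral factor -/

/-- `W` is a spectral factor of `Φ` with linearly independent columns that is analytic in the closed
unit disc and has no zeros in the open unit disc. -/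
structure IsOuterFactor {ι κ : Type*} [Fintype ι] [Fintype κ] [DecidableEq κ]
    (Φ : Matrix ι ι (RatFunc ℂ)) (W : Matrix ι κ (RatFunc ℂ)) : Prop where
  eq_mul : Φ = W * W.conjTranspose
  exists_left_inv : ∃ L : Matrix κ ι (RatFunc ℂ), L * W = 1
  reg : ∀ s : ℂ, ‖s‖ ≤ 1 → MReg s W
  inj : ∀ s : ℂ, ‖s‖ < 1 → ∀ v, (mval s W).mulVec v = 0 → v = 0

section Uniqueness

variable {ι κ : Type*} [Fintype ι] [Fintype κ] [DecidableEq κ]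
  {Φ : Matrix ι ι (RatFunc ℂ)} {W W' : Matrix ι κ (RatFunc ℂ)}

theorem IsOuterFactor.unique (h : IsOuterFactor Φ W) (h' : IsOuterFactor Φ W') :
    ∃ U ∈ Matrix.unitaryGroup κ ℂ, W' = W * U.map RatFunc.C := by
  obtain ⟨L, hL⟩ := h.exists_left_inv
  obtain ⟨L', hL'⟩ := h'.exists_left_inv
  have hΦ : W * W.conjTranspose = W' * W'.conjTranspose := h.eq_mul.symm.trans h'.eq_mul
  have hLs : W.conjTranspose * L.conjTranspose = 1 := by
    rw [← Matrix.conjTranspose_mul, hL, Matrix.conjTranspose_one]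
  have hLs' : W'.conjTranspose * L'.conjTranspose = 1 := by
    rw [← Matrix.conjTranspose_mul, hL', Matrix.conjTranspose_one]
  -- `L'*` is a right inverse of `W'*`, so cancelling `W'*` in `W W* = W' W'*` produces exactly this
  -- `T`.
  set T := W.conjTranspose * L'.conjTranspose with hT
  have hWT : W * T = W' := by
    rw [hT, ← Matrix.mul_assoc, hΦ, Matrix.mul_assoc, hLs', Matrix.mul_one]
  have hTT : T * T.conjTranspose = 1 := by
    have e : W * (T * T.conjTranspose) * W.conjTranspose = W * W.conjTranspose := by
      rw [hΦ, ← hWT, Matrix.conjTranspose_mul W T]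
      simp only [Matrix.mul_assoc]
    calc T * T.conjTranspose
        = (L * W) * (T * T.conjTranspose) * (W.conjTranspose * L.conjTranspose) := by
          rw [hL, hLs, Matrix.one_mul, Matrix.mul_one]
      _ = L * (W * (T * T.conjTranspose) * W.conjTranspose) * L.conjTranspose := by
          simp only [Matrix.mul_assoc]
      _ = (L * W) * (W.conjTranspose * L.conjTranspose) := by
          rw [e]; simp only [Matrix.mul_assoc]
      _ = 1 := by rw [hL, hLs, Matrix.one_mul]
  have hTT' : T.conjTranspose * T = 1 := mul_eq_one_comm.mp hTT
  have hWT' : W' * T.conjTranspose = W := by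
    rw [← hWT, Matrix.mul_assoc, hTT, Matrix.mul_one]
  have hreg : ∀ s : ℂ, ‖s‖ ≤ 1 → MReg s T := by
    intro s hs
    -- Injectivity of `W` is known only in the open disc; on the circle `T T* = 1` takes its place.
    rcases hs.lt_or_eq with hs' | hs'
    · exact mReg_of_mul_eq (h.reg s hs) (h.inj s hs') (hWT ▸ h'.reg s hs)
    · exact mReg_of_mul_conjTranspose hs' (hTT ▸ mReg_one s)
  have hreg' : ∀ s : ℂ, ‖s‖ ≤ 1 → MReg s T.conjTranspose := by
    intro s hs
    rcases hs.lt_or_eq with hs' | hs'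
    · exact mReg_of_mul_eq (h'.reg s hs) (h'.inj s hs') (hWT'.symm ▸ h.reg s hs)
    · exact (hreg s hs).conjTranspose hs'
  -- Outside the disc and at infinity, `T` is the `star` of an entry of `T*` at the reflected point,
  -- which lies in the disc.
  have hconst : ∀ i j, ∃ a, T i j = RatFunc.C a := by
    intro i j
    have hst : T i j = star (T.conjTranspose j i) := by
      rw [Matrix.conjTranspose_apply, star_star]
    refine eq_C_of_reg (fun s => ?_) ?_
    · rcases le_or_gt ‖s‖ 1 with hs | hs
      · exact hreg s hs i j
      · have hs0 : s ≠ 0 := by rintro rfl; simp at hs; linarith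
        have h1 := hreg' (starRingEnd ℂ s)⁻¹ (by
          rw [norm_inv, RCLike.norm_conj]; exact inv_le_one_of_one_le₀ hs.le) j i
        have h2 := (h1.star_and_val (by simpa using hs0)).1
        rw [hst]
        simpa using h2
    · have h1 := (hreg' 0 (by simp) j i).conjHom_and_val.1
      rw [map_zero] at h1
      rw [hst, star_eq, invHom_invHom]
      exact h1
  choose U hU using hconst
  have hTU : T = (Matrix.of U).map RatFunc.C := by ext i j; simp [hU]
  refine ⟨Matrix.of U, ?_, by rw [← hTU, hWT]⟩
  rw [Matrix.mem_unitaryGroup_iff, Matrix.star_eq_conjTranspose]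
  have := congrArg (mval 0) hTT
  rw [hTU, map_C_conjTranspose, mval_mul (mReg_map_C _ _) (mReg_map_C _ _), mval_map_C,
    mval_map_C] at this
  rw [this]
  ext i j
  by_cases hij : i = j
  · subst hij; simp [mval]
  · simp [mval, Matrix.one_apply_ne hij]

end Uniqueness

/-! ### Properties that hold at almost all points of the unit circle -/

/-- The filter of properties that hold at all but finitely many points of the unit circle. -/
def circleFilter : Filter ℂ := Filter.cofinite ⊓ Filter.principal {z | ‖z‖ = 1}

theorem eventually_circle_norm : ∀ᶠ z in circleFilter, ‖z‖ = 1 :=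
  Filter.mem_inf_of_right (Filter.mem_principal_self _)

theorem eventually_circle_of_finite {p : ℂ → Prop} (h : {z | ¬ p z}.Finite) :
    ∀ᶠ z in circleFilter, p z :=
  Filter.mem_inf_of_left (by simpa [Filter.mem_cofinite, Set.compl_def] using h)

theorem eventually_circle_reg (f : RatFunc ℂ) : ∀ᶠ z in circleFilter, Reg z f :=
  eventually_circle_of_finite (finite_not_reg f)

theorem eventually_circle_val_ne_zero {f : RatFunc ℂ} (hf : f ≠ 0) :
    ∀ᶠ z in circleFilter, val z f ≠ 0 :=
  eventually_circle_of_finite (by simpa using finite_val_eq_zero hf)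

/-- The arc through `a` has nonzero velocity at `θ = 0`, so near `0` it avoids any finite set except
possibly at `θ = 0`. This makes one-variable calculus available at each point of the circle. -/
theorem tendsto_circleFilter {a : ℂ} (ha : ‖a‖ = 1) :
    Filter.Tendsto (fun θ : ℝ => a * Complex.exp (θ * Complex.I)) (nhdsWithin 0 {0}ᶜ)
      circleFilter := by
  have ha0 := ne_zero_of_norm_eq_one ha
  refine Filter.tendsto_inf.mpr ⟨?_, Filter.tendsto_principal.mpr ?_⟩
  · have hd : HasDerivAt (fun θ : ℝ => a * Complex.exp (θ * Complex.I))
        (a * (Complex.exp ((0 : ℝ) * Complex.I) * (1 * Complex.I))) (0 : ℝ) :=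
      (((Complex.ofRealCLM.hasDerivAt (x := (0 : ℝ))).mul_const Complex.I).cexp).const_mul a
    have h1 := hd.tendsto_nhdsNE (by simpa using ha0)
    exact h1.mono_right (nhdsNE_le_cofinite _)
  · filter_upwards with θ
    simp [ha, Complex.norm_exp_ofReal_mul_I]

instance : circleFilter.NeBot :=
  (tendsto_circleFilter (a := 1) (by simp)).neBot

theorem eq_zero_of_eventually_val_eq_zero {f : RatFunc ℂ}
    (h : ∀ᶠ z in circleFilter, val z f = 0) : f = 0 := by
  by_contra hf
  obtain ⟨z, h1, h2⟩ := (h.and (eventually_circle_val_ne_zero hf)).exists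
  exact h2 h1

theorem star_eq_self_of_nonneg {d : RatFunc ℂ} (h : ∀ᶠ z in circleFilter, 0 ≤ val z d) :
    star d = d := by
  rw [← sub_eq_zero]
  apply eq_zero_of_eventually_val_eq_zero
  filter_upwards [h, eventually_circle_norm, eventually_circle_reg d] with z h0 hz hr
  rw [val_sub (hr.star_of_norm_eq_one hz) hr, val_star_of_norm_eq_one hz hr, sub_eq_zero]
  exact RCLike.conj_eq_iff_im.mpr (Complex.le_def.mp h0).2.symm

/-! ### The scalar Fejér–Riesz theorem -/

theorem val_mul_star {z : ℂ} (hz : ‖z‖ = 1) {f : RatFunc ℂ} (hf : Reg z f) :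
    val z (f * star f) = ((‖val z f‖ ^ 2 : ℝ) : ℂ) := by
  rw [val_mul hf (hf.star_of_norm_eq_one hz), val_star_of_norm_eq_one hz hf, Complex.mul_conj,
    Complex.normSq_eq_norm_sq]

theorem nonneg_mul_star {d f : RatFunc ℂ} (h : ∀ᶠ z in circleFilter, 0 ≤ val z d) :
    ∀ᶠ z in circleFilter, 0 ≤ val z (f * star f * d) := by
  filter_upwards [h, eventually_circle_norm, eventually_circle_reg d, eventually_circle_reg f]
    with z h0 hz hd hf
  rw [val_mul (hf.mul (hf.star_of_norm_eq_one hz)) hd, val_mul_star hz hf]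
  exact mul_nonneg (Complex.zero_le_real.mpr (sq_nonneg _)) h0

theorem nonneg_of_mul_star {d f : RatFunc ℂ} (hf0 : f ≠ 0)
    (h : ∀ᶠ z in circleFilter, 0 ≤ val z (f * star f * d)) :
    ∀ᶠ z in circleFilter, 0 ≤ val z d := by
  have := nonneg_mul_star (f := f⁻¹) h
  have e : f⁻¹ * star f⁻¹ * (f * star f * d) = d := by
    have : star f ≠ 0 := star_ne_zero.mpr hf0
    rw [star_inv₀]
    field_simp
  rwa [e] at this

/-- A nonnegative trigonometric polynomial has only multiple zeros on the unit circle. -/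
theorem eval_eq_zero_of_nonneg {a : ℂ} (ha : ‖a‖ = 1) (k : ℤ) (P : Polynomial ℂ)
    (h : ∀ᶠ z in circleFilter, 0 ≤ z ^ k * ((z - a) * P.eval z)) : P.eval a = 0 := by
  have ha0 := ne_zero_of_norm_eq_one ha
  set z : ℝ → ℂ := fun θ => a * Complex.exp (θ * Complex.I) with hz
  have hd : HasDerivAt z (a * (Complex.exp ((0 : ℝ) * Complex.I) * (1 * Complex.I))) (0 : ℝ) :=
    (((Complex.ofRealCLM.hasDerivAt (x := (0 : ℝ))).mul_const Complex.I).cexp).const_mul a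
  have hz0 : z 0 = a := by simp [hz]
  have hg : DifferentiableAt ℝ (fun θ => z θ ^ k * P.eval (z θ)) 0 := by
    have hp : DifferentiableAt ℂ (fun w => w ^ k * P.eval w) (z 0) :=
      (differentiableAt_zpow.mpr (Or.inl (by rw [hz0]; exact ha0))).mul
        P.differentiable.differentiableAt
    exact (hp.restrictScalars ℝ).comp 0 hd.differentiableAt
  have hD : HasDerivAt (fun θ => (z θ - a) * (z θ ^ k * P.eval (z θ)))
      (a * Complex.I * (a ^ k * P.eval a)) 0 := by
    convert! (hd.sub_const a).mul hg.hasDerivAt using 1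
    simp [hz0]
  have hev := (tendsto_circleFilter ha).eventually h
  -- In the order of `ℂ`, `0 ≤ w` means real part nonnegative and imaginary part zero. Both parts
  -- are therefore minimal at `θ = 0`, where the function vanishes, and its derivative there is
  -- zero.
  have key : ∀ L : ℂ →L[ℝ] ℝ, (∀ w : ℂ, 0 ≤ w → 0 ≤ L w) →
      L (a * Complex.I * (a ^ k * P.eval a)) = 0 := by
    intro L hL
    have hmin : IsLocalMin (fun θ => L ((z θ - a) * (z θ ^ k * P.eval (z θ)))) 0 := by
      have h2 := eventually_nhdsWithin_iff.mp hev
      filter_upwards [h2] with θ hθ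
      rw [hz0, sub_self, zero_mul, map_zero]
      by_cases h0 : θ = 0
      · rw [h0, hz0, sub_self, zero_mul, map_zero]
      · refine hL _ ?_
        have := hθ h0
        rw [mul_left_comm]
        exact this
    exact hmin.hasDerivAt_eq_zero (L.hasFDerivAt.comp_hasDerivAt 0 hD)
  have h1 := key Complex.reCLM fun w hw => (Complex.le_def.mp hw).1
  have h2 := key Complex.imCLM fun w hw => (Complex.le_def.mp hw).2.le
  have h3 : a * Complex.I * (a ^ k * P.eval a) = 0 := Complex.ext h1 h2
  have hak : a ^ k ≠ 0 := zpow_ne_zero k ha0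
  simpa [ha0, hak] using h3

/-- A zero of a nonnegative trigonometric polynomial comes with its reflection in the circle. -/
theorem dvd_of_nonneg {k : ℤ} {P : Polynomial ℂ} {a : ℂ} (ha0 : a ≠ 0) (ha : P.eval a = 0)
    (h : ∀ᶠ z in circleFilter, 0 ≤
      val z (RatFunc.X ^ k * algebraMap (Polynomial ℂ) (RatFunc ℂ) P)) :
    ∃ Q, P = (Polynomial.X - Polynomial.C a) *
      ((Polynomial.X - Polynomial.C (starRingEnd ℂ a)⁻¹) * Q) := by
  obtain ⟨P₁, rfl⟩ := Polynomial.dvd_iff_isRoot.mpr ha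
  have hX : ∀ {z : ℂ}, z ≠ 0 → Reg z ((RatFunc.X : RatFunc ℂ) ^ k) := fun hz =>
    (reg_X _).zpow (by simpa using hz) k
  have hval : ∀ {z : ℂ}, z ≠ 0 → ∀ P : Polynomial ℂ,
      val z (RatFunc.X ^ k * algebraMap (Polynomial ℂ) (RatFunc ℂ) P) = z ^ k * P.eval z :=
    fun hz P => by
      rw [val_mul (hX hz) (by simp), val_zpow (reg_X _) (by simpa using hz)]; simp
  set b := (starRingEnd ℂ a)⁻¹ with hb
  have hb0 : b ≠ 0 := by simpa [hb] using ha0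
  suffices hP : P₁.eval b = 0 by
    obtain ⟨Q, rfl⟩ := Polynomial.dvd_iff_isRoot.mpr hP
    exact ⟨Q, rfl⟩
  by_cases hn : ‖a‖ = 1
  · rw [hb, conj_inv_of_norm_eq_one hn]
    refine eval_eq_zero_of_nonneg hn k P₁ ?_
    filter_upwards [h, eventually_circle_norm] with z h0 hz
    rw [hval (ne_zero_of_norm_eq_one hz)] at h0
    simpa using h0
  · have hab : b ≠ a := by
      intro e
      apply hn
      have : a * starRingEnd ℂ a = 1 := by
        nth_rewrite 1 [← e]
        rw [hb]
        exact inv_mul_cancel₀ (by simpa using ha0)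
      rw [Complex.mul_conj, Complex.normSq_eq_norm_sq] at this
      have h2 : ‖a‖ ^ 2 = 1 := by exact_mod_cast this
      nlinarith [norm_nonneg a]
    -- Being real on the circle, the function equals its `star`, so its zero at `a` is reflected to
    -- a zero at `b ≠ a`.
    have hs := star_eq_self_of_nonneg h
    have h1 := (((hX ha0).mul (reg_algebraMap a ((Polynomial.X - Polynomial.C a) * P₁))).star_and_val
      ha0).2
    rw [hs, hval ha0, hval hb0, ha, mul_zero, map_zero] at h1
    simpa [hb0, sub_eq_zero, hab, zpow_ne_zero] using h1

theorem X_sub_C_mul_star {a : ℂ} (ha0 : a ≠ 0) :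
    (RatFunc.X - RatFunc.C a : RatFunc ℂ) * star (RatFunc.X - RatFunc.C a) * RatFunc.X *
      RatFunc.C (-(starRingEnd ℂ a)⁻¹) =
    (RatFunc.X - RatFunc.C a) * (RatFunc.X - RatFunc.C (starRingEnd ℂ a)⁻¹) := by
  have hX := RatFunc.X_ne_zero (K := ℂ)
  have hc : RatFunc.C (starRingEnd ℂ a) ≠ 0 := by simpa using ha0
  rw [star_sub, star_X, star_C, map_neg, map_inv₀]
  field_simp
  ring

/-- A root at `0` is absorbed into the monomial. A root `a ≠ 0` comes with its reflection, and by
`X_sub_C_mul_star` the pair is `(X - a)(X - a)*` up to a constant and a power of `X`, so the degree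
drops by two. What remains is a monomial `c z^k`; being self-adjoint it has `k = 0`, and then `c ≥
0` has a square root. -/
theorem exists_eq_mul_star_of_natDegree (n : ℕ) : ∀ (P : Polynomial ℂ) (k : ℤ), P.natDegree = n →
    (∀ᶠ z in circleFilter, 0 ≤
      val z (RatFunc.X ^ k * algebraMap (Polynomial ℂ) (RatFunc ℂ) P)) →
    ∃ f : RatFunc ℂ, RatFunc.X ^ k * algebraMap (Polynomial ℂ) (RatFunc ℂ) P = f * star f := by
  have hX := RatFunc.X_ne_zero (K := ℂ)
  induction n using Nat.strong_induction_on with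
  | _ n ih =>
  intro P k hn h
  by_cases hP : P = 0
  · exact ⟨0, by simp [hP]⟩
  by_cases hn0 : n = 0
  · obtain ⟨c, rfl⟩ := Polynomial.natDegree_eq_zero.mp (hn.trans hn0)
    have hc : c ≠ 0 := by rintro rfl; simp at hP
    have hs := star_eq_self_of_nonneg h
    rw [RatFunc.algebraMap_C] at hs h ⊢
    have hs' : RatFunc.C (starRingEnd ℂ c) = RatFunc.X ^ (2 * k) * RatFunc.C c := by
      rw [star_mul', star_zpow₀, star_X, star_C, inv_zpow] at hs
      rw [two_mul, zpow_add₀ hX, mul_assoc, ← hs, mul_inv_cancel_left₀ (zpow_ne_zero k hX)]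
    have h1 : ∀ z : ℂ, z ≠ 0 → starRingEnd ℂ c = z ^ (2 * k) * c := by
      intro z hz
      have := congrArg (val z) hs'
      rwa [val_mul ((reg_X z).zpow (by simpa using hz) _) (reg_C _ _),
        val_zpow (reg_X z) (by simpa using hz), val_C, val_C, val_X] at this
    have hk : k = 0 := by
      have h2 := (h1 1 one_ne_zero).symm.trans (h1 2 two_ne_zero)
      rw [one_zpow, one_mul] at h2
      have h3 : (2 : ℂ) ^ (2 * k) = 1 := by
        simpa [hc] using h2.symm
      have h4 : (2 : ℝ) ^ (2 * k) = (2 : ℝ) ^ (0 : ℤ) := by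
        rw [zpow_zero]
        apply Complex.ofReal_injective
        push_cast
        exact h3
      have := zpow_right_injective₀ (by norm_num : (0 : ℝ) < 2) (by norm_num) h4
      omega
    subst hk
    obtain ⟨z, hz⟩ := h.exists
    rw [zpow_zero, one_mul, val_C] at hz
    obtain ⟨hre, him⟩ := Complex.le_def.mp hz
    refine ⟨RatFunc.C (Real.sqrt c.re : ℂ), ?_⟩
    rw [zpow_zero, one_mul, star_C, ← map_mul, Complex.conj_ofReal, ← Complex.ofReal_mul,
      Real.mul_self_sqrt hre]
    congr 1
    exact Complex.ext (by simp) (by simpa using him.symm)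
  obtain ⟨a, ha⟩ := IsAlgClosed.exists_root P (by
    intro h; exact hn0 (hn ▸ Polynomial.natDegree_eq_of_degree_eq_some h))
  by_cases ha0 : a = 0
  · subst ha0
    obtain ⟨Q, rfl⟩ := Polynomial.dvd_iff_isRoot.mpr ha
    have hQ : Q ≠ 0 := right_ne_zero_of_mul hP
    rw [Polynomial.natDegree_mul (Polynomial.X_sub_C_ne_zero 0) hQ,
      Polynomial.natDegree_X_sub_C] at hn
    have e : (RatFunc.X : RatFunc ℂ) ^ k * algebraMap (Polynomial ℂ) (RatFunc ℂ)
        ((Polynomial.X - Polynomial.C 0) * Q) =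
        RatFunc.X ^ (k + 1) * algebraMap (Polynomial ℂ) (RatFunc ℂ) Q := by
      rw [zpow_add_one₀ hX]
      simp [mul_assoc]
    rw [e] at h ⊢
    exact ih _ (by omega) Q (k + 1) rfl h
  · obtain ⟨Q, rfl⟩ := dvd_of_nonneg ha0 ha h
    set b := (starRingEnd ℂ a)⁻¹ with hb
    have hb0 : b ≠ 0 := by simpa [hb] using ha0
    have hQ : Q ≠ 0 := right_ne_zero_of_mul (right_ne_zero_of_mul hP)
    rw [Polynomial.natDegree_mul (Polynomial.X_sub_C_ne_zero _)
      (mul_ne_zero (Polynomial.X_sub_C_ne_zero _) hQ),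
      Polynomial.natDegree_mul (Polynomial.X_sub_C_ne_zero _) hQ,
      Polynomial.natDegree_X_sub_C, Polynomial.natDegree_X_sub_C] at hn
    have e : (RatFunc.X : RatFunc ℂ) ^ k * algebraMap (Polynomial ℂ) (RatFunc ℂ)
        ((Polynomial.X - Polynomial.C a) * ((Polynomial.X - Polynomial.C b) * Q)) =
        (RatFunc.X - RatFunc.C a) * star (RatFunc.X - RatFunc.C a) *
          (RatFunc.X ^ (k + 1) * algebraMap (Polynomial ℂ) (RatFunc ℂ) (Polynomial.C (-b) * Q)) := by
      have := X_sub_C_mul_star ha0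
      rw [← hb] at this
      rw [zpow_add_one₀ hX]
      simp only [map_mul, map_sub, RatFunc.algebraMap_X, RatFunc.algebraMap_C]
      linear_combination (-(RatFunc.X : RatFunc ℂ) ^ k *
        algebraMap (Polynomial ℂ) (RatFunc ℂ) Q) * this
    rw [e] at h ⊢
    obtain ⟨f, hf⟩ := ih (Polynomial.C (-b) * Q).natDegree (by
      rw [Polynomial.natDegree_C_mul (neg_ne_zero.mpr hb0)]; omega) _ (k + 1) rfl
      (nonneg_of_mul_star (X_sub_C_ne_zero a) h)
    refine ⟨(RatFunc.X - RatFunc.C a) * f, ?_⟩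
    rw [hf, star_mul']
    ring

/-- **Fejér–Riesz theorem** for scalar rational functions. -/
theorem exists_eq_mul_star {d : RatFunc ℂ} (h : ∀ᶠ z in circleFilter, 0 ≤ val z d) :
    ∃ f : RatFunc ℂ, d = f * star f := by
  have hX := RatFunc.X_ne_zero (K := ℂ)
  -- Multiplying by `q q*` preserves nonnegativity and turns `d` into a Laurent polynomial, since
  -- `q*` is one.
  set q : RatFunc ℂ := algebraMap (Polynomial ℂ) (RatFunc ℂ) d.denom with hq
  have hq0 : q ≠ 0 := RatFunc.algebraMap_ne_zero d.denom_ne_zero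
  have hqs : star q ≠ 0 := star_ne_zero.mpr hq0
  set r : Polynomial ℂ := d.denom.map (starRingEnd ℂ) with hr
  have hst : star q = RatFunc.X ^ (-(r.natDegree : ℤ)) *
      algebraMap (Polynomial ℂ) (RatFunc ℂ) r.reverse := by
    rw [star_eq, hq, conjHom_algebraMap, ← hr, ← X_pow_mul_invHom, zpow_neg, zpow_natCast,
      inv_mul_cancel_left₀ (pow_ne_zero _ hX)]
  have e : q * star q * d = RatFunc.X ^ (-(r.natDegree : ℤ)) *
      algebraMap (Polynomial ℂ) (RatFunc ℂ) (r.reverse * d.num) := by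
    have h1 : q * d = algebraMap (Polynomial ℂ) (RatFunc ℂ) d.num := by
      conv_lhs => rw [← RatFunc.num_div_denom d, ← hq]
      field_simp
    rw [mul_right_comm, h1, hst, map_mul]
    ring
  have h2 := nonneg_mul_star (f := q) h
  rw [e] at h2
  obtain ⟨f, hf⟩ := exists_eq_mul_star_of_natDegree _ _ _ rfl h2
  refine ⟨f / q, ?_⟩
  rw [← e] at hf
  rw [div_eq_mul_inv, star_mul', star_inv₀]
  field_simp
  linear_combination hf

/-! ### Rational factorization of a matrix that is positive semidefinite on the circle -/

section Factorization

variable {ι κ : Type*}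

theorem eventually_circle_mReg [Finite ι] [Finite κ] (A : Matrix ι κ (RatFunc ℂ)) :
    ∀ᶠ z in circleFilter, MReg z A :=
  Filter.eventually_all.mpr fun _ => Filter.eventually_all.mpr fun _ => eventually_circle_reg _

theorem conjTranspose_eq_self_of_posSemidef [Finite ι] {Φ : Matrix ι ι (RatFunc ℂ)}
    (h : ∀ᶠ z in circleFilter, (mval z Φ).PosSemidef) : Φ.conjTranspose = Φ := by
  ext i j
  rw [← sub_eq_zero]
  apply eq_zero_of_eventually_val_eq_zero
  filter_upwards [h, eventually_circle_norm, eventually_circle_mReg Φ] with z h0 hz hr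
  rw [val_sub (hr.conjTranspose hz i j) (hr i j), sub_eq_zero]
  have h1 := congrFun (congrFun h0.isHermitian i) j
  rw [← mval_conjTranspose hz hr] at h1
  exact h1

theorem eq_zero_of_posSemidef_of_diag [Fintype ι] {Φ : Matrix ι ι (RatFunc ℂ)}
    (h : ∀ᶠ z in circleFilter, (mval z Φ).PosSemidef) (hd : ∀ i, Φ i i = 0) : Φ = 0 := by
  ext i j
  apply eq_zero_of_eventually_val_eq_zero
  filter_upwards [h] with z h0
  have h1 : mval z Φ = 0 := by
    rw [← h0.trace_eq_zero_iff, Matrix.trace]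
    exact Finset.sum_eq_zero fun i _ => by simp [mval, hd]
  exact congrFun (congrFun h1 i) j

/-- Elimination of the row and the column of the pivot `Φ i i`. -/
def pivotElim (Φ : Matrix ι ι (RatFunc ℂ)) (i : ι) : Matrix ι ι (RatFunc ℂ) :=
  Matrix.of fun a b => Φ a b - Φ a i * Φ i b / Φ i i

/-- Elimination is the congruence `(1 - E)* Φ (1 - E)`: the right factor clears column `i`, and the
left factor then changes nothing because row `i` is zero as well. -/
theorem pivotElim_posSemidef [Fintype ι] {Φ : Matrix ι ι (RatFunc ℂ)} {i : ι}
    (hi : Φ i i ≠ 0) (h : ∀ᶠ z in circleFilter, (mval z Φ).PosSemidef) :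
    ∀ᶠ z in circleFilter, (mval z (pivotElim Φ i)).PosSemidef := by
  classical
  set E : Matrix ι ι (RatFunc ℂ) := Matrix.of fun a b => if a = i then Φ i b / Φ i i else 0 with hE
  have e1 : Φ * (1 - E) = pivotElim Φ i := by
    ext a b
    rw [Matrix.mul_sub, Matrix.mul_one, Matrix.sub_apply, Matrix.mul_apply]
    simp [hE, pivotElim, mul_div_assoc]
  have e2 : E.conjTranspose * pivotElim Φ i = 0 := by
    ext a b
    rw [Matrix.mul_apply]
    refine Finset.sum_eq_zero fun x _ => ?_
    by_cases hx : x = i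
    · subst hx
      simp [pivotElim, hi]
    · simp [hE, hx]
  have e : (1 - E).conjTranspose * Φ * (1 - E) = pivotElim Φ i := by
    rw [Matrix.mul_assoc, e1, Matrix.conjTranspose_sub, Matrix.conjTranspose_one, Matrix.sub_mul,
      e2, Matrix.one_mul, sub_zero]
  filter_upwards [h, eventually_circle_norm, eventually_circle_mReg Φ,
    eventually_circle_mReg (1 - E)] with z h0 hz hr hB
  rw [← e, mval_mul ((hB.conjTranspose hz).mul hr) hB, mval_mul (hB.conjTranspose hz) hr,
    mval_conjTranspose hz hB]
  exact h0.conjTranspose_mul_mul_same _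

/-- The column space shrinks strictly: after elimination all its vectors have `i`-th coordinate
zero, while column `i` of `Φ` does not. -/
theorem pivotElim_rank_lt [Fintype ι] {Φ : Matrix ι ι (RatFunc ℂ)} {i : ι} (hi : Φ i i ≠ 0) :
    (pivotElim Φ i).rank < Φ.rank := by
  classical
  refine Submodule.finrank_lt_finrank_of_lt (lt_of_le_of_ne ?_ fun heq => ?_)
  · rintro _ ⟨v, rfl⟩
    refine ⟨v - Pi.single i ((∑ b, Φ i b * v b) / Φ i i), ?_⟩
    ext a
    have h1 : Φ.mulVecLin (v - Pi.single i ((∑ b, Φ i b * v b) / Φ i i)) a =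
        ∑ b, Φ a b * v b - Φ a i * ((∑ b, Φ i b * v b) / Φ i i) := by
      rw [Matrix.mulVecLin_apply, Matrix.mulVec_sub, Pi.sub_apply, Matrix.mulVec_single]
      rfl
    have h2 : (pivotElim Φ i).mulVecLin v a =
        ∑ b, (Φ a b - Φ a i * Φ i b / Φ i i) * v b := rfl
    rw [h1, h2]
    simp only [sub_mul, Finset.sum_sub_distrib]
    congr 1
    rw [← mul_div_assoc, Finset.mul_sum, Finset.sum_div]
    exact Finset.sum_congr rfl fun b _ => by ring
  · have hmem : Φ.mulVec (Pi.single i 1) ∈ LinearMap.range Φ.mulVecLin := ⟨_, rfl⟩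
    rw [← heq] at hmem
    obtain ⟨v, hv⟩ := hmem
    have h1 := congrFun hv i
    have h2 : (pivotElim Φ i).mulVecLin v i = 0 :=
      Finset.sum_eq_zero fun b _ => by simp [pivotElim, hi]
    rw [h2, Matrix.mulVec_single_one] at h1
    exact hi h1.symm

theorem exists_eq_mul_conjTranspose [Fintype ι] (r : ℕ) : ∀ Φ : Matrix ι ι (RatFunc ℂ),
    Φ.rank ≤ r → (∀ᶠ z in circleFilter, (mval z Φ).PosSemidef) →
    ∃ W : Matrix ι (Fin r) (RatFunc ℂ), Φ = W * W.conjTranspose := by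
  induction r with
  | zero =>
    intro Φ hr h
    refine ⟨0, ?_⟩
    rw [Matrix.zero_mul]
    refine eq_zero_of_posSemidef_of_diag h fun i => ?_
    by_contra hi
    have := pivotElim_rank_lt hi
    omega
  | succ r ih =>
    intro Φ hr h
    by_cases hd : ∀ i, Φ i i = 0
    · exact ⟨0, by rw [Matrix.zero_mul, eq_zero_of_posSemidef_of_diag h hd]⟩
    push Not at hd
    obtain ⟨i, hi⟩ := hd
    have hrank := pivotElim_rank_lt hi
    obtain ⟨W, hW⟩ := ih (pivotElim Φ i) (by omega) (pivotElim_posSemidef hi h)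
    obtain ⟨f, hf⟩ := exists_eq_mul_star (d := Φ i i) (by
      filter_upwards [h] with z h0
      exact h0.diag_nonneg)
    have hf0 : f ≠ 0 := by rintro rfl; simp [hf] at hi
    have hfs : star f ≠ 0 := star_ne_zero.mpr hf0
    have hherm : ∀ a, star (Φ a i) = Φ i a := fun a =>
      congrFun (congrFun (conjTranspose_eq_self_of_posSemidef h) i) a
    -- With `Φ i i = f f*`, the new column times its conjugate transpose is the rank-one term
    -- subtracted by `pivotElim`.
    refine ⟨Matrix.of fun a => Fin.cons (Φ a i / star f) (W a), ?_⟩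
    ext a b
    have hab := congrFun (congrFun hW a) b
    rw [Matrix.mul_apply] at hab ⊢
    rw [Fin.sum_univ_succ]
    simp only [Matrix.conjTranspose_apply, Matrix.of_apply, Fin.cons_zero, Fin.cons_succ] at hab ⊢
    rw [← hab, pivotElim, Matrix.of_apply, hf, div_eq_mul_inv (Φ b i), star_mul', star_inv₀,
      star_star, hherm]
    field_simp
    ring

end Factorization

/-! ### Selection of independent rows -/

theorem exists_submatrix_det_ne_zero {ι K : Type*} [Finite ι] [Field K] {m : ℕ}
    (W : Matrix ι (Fin m) K) (h : W.rank = m) :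
    ∃ e : Fin m → ι, (W.submatrix e id).det ≠ 0 := by
  obtain ⟨f, hf, -, hli⟩ := Submodule.exists_fun_fin_finrank_span_eq K (Set.range W.row)
  have hm : Module.finrank K (Submodule.span K (Set.range W.row)) = m := by
    rw [← W.rank_eq_finrank_span_row, h]
  choose e he using hf
  refine ⟨fun i => e (Fin.cast hm.symm i), ?_⟩
  rw [← isUnit_iff_ne_zero, ← Matrix.isUnit_iff_isUnit_det, ← Matrix.linearIndependent_rows_iff_isUnit]
  have h2 : (W.submatrix (fun i => e (Fin.cast hm.symm i)) id).row = f ∘ Fin.cast hm.symm := by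
    funext i
    exact he _
  rw [h2]
  exact hli.comp _ (Fin.cast_injective _)

theorem exists_left_inv_of_submatrix_det_ne_zero {ι K : Type*} [Fintype ι] [Field K] {m : ℕ}
    {W : Matrix ι (Fin m) K} {e : Fin m → ι} (h : (W.submatrix e id).det ≠ 0) :
    ∃ L : Matrix (Fin m) ι K, L * W = 1 := by
  classical
  refine ⟨(W.submatrix e id)⁻¹ * (1 : Matrix ι ι K).submatrix e id, ?_⟩
  have : (1 : Matrix ι ι K).submatrix e id * W = W.submatrix e id := by
    ext i j
    simp [Matrix.mul_apply, Matrix.one_apply]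
  rw [Matrix.mul_assoc, this, Matrix.nonsing_inv_mul _ (isUnit_iff_ne_zero.mpr h)]

/-! ### Blaschke factors -/

/-- The polynomial `1 - conj a * z`, as a rational function. -/
def blaschkeDen (a : ℂ) : RatFunc ℂ := 1 - RatFunc.C (starRingEnd ℂ a) * RatFunc.X

/-- The Blaschke factor with zero `a`. -/
def blaschke (a : ℂ) : RatFunc ℂ := (RatFunc.X - RatFunc.C a) / blaschkeDen a

theorem reg_blaschkeDen (t a : ℂ) : Reg t (blaschkeDen a) :=
  (reg_one t).sub ((reg_C t _).mul (reg_X t))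

theorem val_blaschkeDen (t a : ℂ) : val t (blaschkeDen a) = 1 - starRingEnd ℂ a * t := by
  rw [blaschkeDen, val_sub (reg_one t) ((reg_C t _).mul (reg_X t)), val_mul (reg_C t _) (reg_X t)]
  simp

theorem val_blaschkeDen_ne_zero {t a : ℂ} (ha : ‖a‖ < 1) (ht : ‖t‖ ≤ 1) :
    val t (blaschkeDen a) ≠ 0 := by
  rw [val_blaschkeDen, sub_ne_zero]
  intro h
  have := congrArg norm h
  rw [norm_one, norm_mul, RCLike.norm_conj] at this
  nlinarith [norm_nonneg a, norm_nonneg t]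

theorem blaschkeDen_ne_zero (a : ℂ) : blaschkeDen a ≠ 0 := by
  intro h
  have := val_blaschkeDen 0 a
  rw [h] at this
  simp at this

theorem reg_blaschke {t a : ℂ} (ha : ‖a‖ < 1) (ht : ‖t‖ ≤ 1) : Reg t (blaschke a) :=
  (reg_X_sub_C t a).div (reg_blaschkeDen t a) (val_blaschkeDen_ne_zero ha ht)

theorem star_blaschke (a : ℂ) : star (blaschke a) = blaschkeDen a / (RatFunc.X - RatFunc.C a) := by
  have hX := RatFunc.X_ne_zero (K := ℂ)
  have h1 := X_sub_C_ne_zero a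
  have h2 : star (blaschkeDen a) = (RatFunc.X - RatFunc.C a) / RatFunc.X := by
    simp only [blaschkeDen, star_sub, star_one, star_mul', star_X, star_C, Complex.conj_conj]
    field_simp
  have h3 : star (RatFunc.X - RatFunc.C a) = blaschkeDen a / RatFunc.X := by
    simp only [blaschkeDen, star_sub, star_X, star_C]
    field_simp
  rw [blaschke, div_eq_mul_inv, star_mul', star_inv₀, h2, h3]
  field_simp

theorem blaschke_mul_star (a : ℂ) : blaschke a * star (blaschke a) = 1 := by
  have h1 := X_sub_C_ne_zero a
  have h2 := blaschkeDen_ne_zero a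
  rw [star_blaschke, blaschke]
  field_simp

/-- Poles in the open unit disc can be compensated by a scalar all-pass function. -/
theorem exists_allPass (n : ℕ) : ∀ q : Polynomial ℂ, q ≠ 0 → q.natDegree = n →
    ∃ g : RatFunc ℂ, g * star g = 1 ∧ (∀ s : ℂ, ‖s‖ ≤ 1 → Reg s g) ∧
      ∀ s : ℂ, ‖s‖ < 1 → Reg s (g / algebraMap (Polynomial ℂ) (RatFunc ℂ) q) := by
  induction n with
  | zero =>
    intro q hq hn
    obtain ⟨c, rfl⟩ := Polynomial.natDegree_eq_zero.mp hn
    have hc : c ≠ 0 := by rintro rfl; simp at hq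
    refine ⟨1, by simp, fun s _ => reg_one s, fun s _ => ?_⟩
    exact (reg_one s).div (reg_algebraMap s _) (by simpa using hc)
  | succ n ih =>
    intro q hq hn
    obtain ⟨a, ha⟩ := IsAlgClosed.exists_root q (by
      intro h; have := Polynomial.natDegree_eq_of_degree_eq_some (n := 0) h; omega)
    obtain ⟨r, rfl⟩ := Polynomial.dvd_iff_isRoot.mpr ha
    have hr : r ≠ 0 := right_ne_zero_of_mul hq
    rw [Polynomial.natDegree_mul (Polynomial.X_sub_C_ne_zero a) hr,
      Polynomial.natDegree_X_sub_C] at hn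
    obtain ⟨g, hg, hg1, hg2⟩ := ih r hr (by omega)
    have h1 := X_sub_C_ne_zero a
    have h0 : algebraMap (Polynomial ℂ) (RatFunc ℂ) r ≠ 0 := RatFunc.algebraMap_ne_zero hr
    have e : algebraMap (Polynomial ℂ) (RatFunc ℂ) ((Polynomial.X - Polynomial.C a) * r) =
        (RatFunc.X - RatFunc.C a) * algebraMap (Polynomial ℂ) (RatFunc ℂ) r := by simp
    rw [e]
    rcases lt_or_ge ‖a‖ 1 with ha1 | ha1
    · refine ⟨blaschke a * g, ?_, fun s hs => (reg_blaschke ha1 hs).mul (hg1 s hs), fun s hs => ?_⟩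
      · rw [star_mul', mul_mul_mul_comm, blaschke_mul_star, hg, one_mul]
      -- The zero of the Blaschke factor cancels the root `a`, leaving a denominator without zeros
      -- in the closed disc.
      · have e2 : blaschke a * g / ((RatFunc.X - RatFunc.C a) *
            algebraMap (Polynomial ℂ) (RatFunc ℂ) r) =
            (g / algebraMap (Polynomial ℂ) (RatFunc ℂ) r) / blaschkeDen a := by
          have h2 := blaschkeDen_ne_zero a
          rw [blaschke]
          field_simp
        rw [e2]
        exact (hg2 s hs).div (reg_blaschkeDen s a) (val_blaschkeDen_ne_zero ha1 hs.le)
    · refine ⟨g, hg, hg1, fun s hs => ?_⟩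
      rw [mul_comm, ← div_div]
      refine (hg2 s hs).div (reg_X_sub_C s a) ?_
      rw [val_X_sub_C, sub_ne_zero]
      rintro rfl
      linarith

/-! ### Removal of poles and zeros -/

section Removal

variable {ι : Type*} [Fintype ι] {m : ℕ}

theorem exists_common_denom {ι κ : Type*} [Fintype ι] [Fintype κ] (W : Matrix ι κ (RatFunc ℂ)) :
    ∃ q : Polynomial ℂ, q ≠ 0 ∧ ∀ i j, ∃ p : Polynomial ℂ,
      W i j = algebraMap (Polynomial ℂ) (RatFunc ℂ) p / algebraMap (Polynomial ℂ) (RatFunc ℂ) q := by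
  have hq : ∏ i, ∏ j, (W i j).denom ≠ 0 :=
    Finset.prod_ne_zero_iff.mpr fun i _ => Finset.prod_ne_zero_iff.mpr fun j _ =>
      (W i j).denom_ne_zero
  refine ⟨_, hq, fun i j => (RatFunc.denom_dvd hq).mp ?_⟩
  exact (Finset.dvd_prod_of_mem (fun j => (W i j).denom) (Finset.mem_univ j)).trans
    (Finset.dvd_prod_of_mem (fun i => ∏ j, (W i j).denom) (Finset.mem_univ i))

/-- The matrix that moves a zero at `s`, with null vector `v`, out of the open unit disc. -/
theorem exists_zero_removal {ι : Type*} {s : ℂ} (hs : ‖s‖ < 1) {W : Matrix ι (Fin m) (RatFunc ℂ)}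
    (hW : ∀ t : ℂ, ‖t‖ ≤ 1 → MReg t W) {v : Fin m → ℂ} (hv : v ≠ 0)
    (hWv : (mval s W).mulVec v = 0) :
    ∃ B : Matrix (Fin m) (Fin m) (RatFunc ℂ), B * B.conjTranspose = 1 ∧
      B.det = star (blaschke s) ∧ ∀ t : ℂ, ‖t‖ ≤ 1 → MReg t (W * B) := by
  set c : ℂ := star v ⬝ᵥ v with hc
  have hc0 : c ≠ 0 := by rwa [hc, Ne, dotProduct_star_self_eq_zero]
  have hcs : star c = c := by
    rw [hc, ← Matrix.star_dotProduct_star, star_star, dotProduct_comm]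
  -- The orthogonal projection onto the line spanned by `v`.
  set Q₀ : Matrix (Fin m) (Fin m) ℂ := c⁻¹ • Matrix.vecMulVec v (star v) with hQ
  have hQs : Q₀.conjTranspose = Q₀ := by
    rw [hQ, Matrix.conjTranspose_smul, Matrix.conjTranspose_vecMulVec, star_star, star_inv₀, hcs]
  have hQQ₀ : Q₀ * Q₀ = Q₀ := by
    rw [hQ, Matrix.smul_mul, Matrix.mul_smul, Matrix.vecMulVec_mul_vecMulVec, ← hc,
      Matrix.vecMulVec_smul, smul_smul, smul_smul, mul_assoc, inv_mul_cancel₀ hc0, mul_one]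
  set β : RatFunc ℂ := star (blaschke s) with hβ
  have hββ : β * star β = 1 := by rw [hβ, star_star, mul_comm, blaschke_mul_star]
  set R : Matrix (Fin m) (Fin m) (RatFunc ℂ) := Q₀.map RatFunc.C with hR
  have hRs : R.conjTranspose = R := by rw [hR, map_C_conjTranspose, hQs]
  have hRR : R * R = R := by rw [hR, ← Matrix.map_mul, hQQ₀]
  -- This matrix multiplies `v` by `β` and fixes its orthogonal complement, so it is para-unitary
  -- with determinant `β`. In the closed disc its only possible pole is at `s`, where `W(s) Q₀ = 0`
  -- cancels it.
  refine ⟨1 + (β - 1) • R, ?_, ?_, fun t ht => ?_⟩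
  · rw [Matrix.conjTranspose_add, Matrix.conjTranspose_one, Matrix.conjTranspose_smul, hRs,
      Matrix.add_mul, Matrix.one_mul, Matrix.mul_add, Matrix.mul_one, Matrix.smul_mul,
      Matrix.mul_smul, hRR, smul_smul, add_assoc, ← add_smul, ← add_smul]
    have : star (β - 1) + (β - 1 + (β - 1) * star (β - 1)) = 0 := by
      rw [star_sub, star_one]
      linear_combination hββ
    rw [this, zero_smul, add_zero]
  · have e : (β - 1) • R = Matrix.replicateCol Unit (fun i => (β - 1) * RatFunc.C (c⁻¹ * v i)) *
        Matrix.replicateRow Unit (fun i => RatFunc.C (star (v i))) := by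
      ext i j
      simp [hR, hQ, Matrix.mul_apply, Matrix.vecMulVec_apply]
      ring
    rw [e, Matrix.det_one_add_replicateCol_mul_replicateRow]
    have e2 : ((fun i => RatFunc.C (star (v i))) ⬝ᵥ fun i => (β - 1) * RatFunc.C (c⁻¹ * v i)) =
        (β - 1) * RatFunc.C (c⁻¹ * c) := by
      rw [hc, dotProduct, dotProduct, Finset.mul_sum, map_sum, Finset.mul_sum]
      refine Finset.sum_congr rfl fun i _ => ?_
      simp only [map_mul, Pi.star_apply]
      ring
    rw [e2, inv_mul_cancel₀ hc0]
    simp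
  · rw [Matrix.mul_add, Matrix.mul_one, Matrix.mul_smul]
    refine (hW t ht).add ?_
    have hWR : MReg t (W * R) := (hW t ht).mul (mReg_map_C t Q₀)
    have hβ1 : β - 1 = (blaschkeDen s - (RatFunc.X - RatFunc.C s)) / (RatFunc.X - RatFunc.C s) := by
      rw [hβ, star_blaschke, sub_div, div_self (X_sub_C_ne_zero s)]
    have hnum : Reg t (blaschkeDen s - (RatFunc.X - RatFunc.C s)) :=
      (reg_blaschkeDen t s).sub (reg_X_sub_C t s)
    by_cases hts : t = s
    · subst hts
      have h0 : mval t (W * R) = 0 := by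
        rw [mval_mul (hW t ht) (mReg_map_C t Q₀), mval_map_C, hQ, Matrix.mul_smul,
          Matrix.mul_vecMulVec, hWv, Matrix.zero_vecMulVec, smul_zero]
      intro i j
      rw [Matrix.smul_apply, smul_eq_mul, hβ1, div_mul_eq_mul_div, mul_div_assoc]
      exact hnum.mul (reg_div_X_sub_C (hWR i j) (congrFun (congrFun h0 i) j))
    · refine MReg.smul ?_ hWR
      rw [hβ1]
      exact hnum.div (reg_X_sub_C t s) (by rw [val_X_sub_C]; exact sub_ne_zero.mpr hts)

/-- Evaluation respects sums and products only at regular points, so it is carried through the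
Leibniz expansion term by term. -/
theorem det_eval_eq_zero {s : ℂ} {A : Matrix (Fin m) (Fin m) (RatFunc ℂ)} (hA : MReg s A)
    {v : Fin m → ℂ} (hv : v ≠ 0) (hAv : (mval s A).mulVec v = 0) :
    Reg s A.det ∧ val s A.det = 0 := by
  have hr : ∀ (σ : Equiv.Perm (Fin m)) (t : Finset (Fin m)), Reg s (∏ i ∈ t, A (σ i) i) ∧
      val s (∏ i ∈ t, A (σ i) i) = ∏ i ∈ t, mval s A (σ i) i := by
    intro σ t
    induction t using Finset.induction_on with
    | empty => simp
    | insert a t ha ih =>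
      rw [Finset.prod_insert ha, Finset.prod_insert ha]
      exact ⟨(hA _ _).mul ih.1, by rw [val_mul (hA _ _) ih.1, ih.2]; rfl⟩
  have hsign : ∀ σ : Equiv.Perm (Fin m), ((Equiv.Perm.sign σ : ℤ) : RatFunc ℂ) =
      RatFunc.C ((Equiv.Perm.sign σ : ℤ) : ℂ) := fun σ => by simp
  have hterm : ∀ σ ∈ (Finset.univ : Finset (Equiv.Perm (Fin m))),
      Reg s (((Equiv.Perm.sign σ : ℤ) : RatFunc ℂ) * ∏ i, A (σ i) i) := fun σ _ => by
    rw [hsign]; exact (reg_C _ _).mul (hr σ _).1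
  rw [Matrix.det_apply']
  refine ⟨reg_sum hterm, ?_⟩
  rw [val_sum hterm, ← Matrix.exists_mulVec_eq_zero_iff.mp ⟨v, hv, hAv⟩, Matrix.det_apply']
  refine Finset.sum_congr rfl fun σ _ => ?_
  rw [hsign, val_mul (reg_C _ _) (hr σ _).1, val_C, (hr σ _).2]

/-- At a zero `s` of `W` the chosen minor vanishes, so `X - s` divides `P`. Zero removal replaces
this factor by `1 - conj s * X`, which has no root in the closed disc, so the number `n` of roots of
`P` in the open disc falls by one. -/
theorem exists_outerFactor_of_countP [DecidablePred fun z : ℂ => ‖z‖ < 1]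
    {Φ : Matrix ι ι (RatFunc ℂ)} (e : Fin m → ι) (n : ℕ) :
    ∀ (W : Matrix ι (Fin m) (RatFunc ℂ)) (P Q : Polynomial ℂ), Φ = W * W.conjTranspose →
    (∀ t : ℂ, ‖t‖ ≤ 1 → MReg t W) → P ≠ 0 →
    (W.submatrix e id).det * algebraMap (Polynomial ℂ) (RatFunc ℂ) Q =
      algebraMap (Polynomial ℂ) (RatFunc ℂ) P →
    P.roots.countP (fun z => ‖z‖ < 1) = n →
    ∃ W' : Matrix ι (Fin m) (RatFunc ℂ), IsOuterFactor Φ W' := by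
  induction n with
  | zero =>
    intro W P Q hΦ hW hP hdet hn
    refine ⟨W, hΦ, exists_left_inv_of_submatrix_det_ne_zero (e := e) ?_, hW, ?_⟩
    · intro h0
      rw [h0, zero_mul] at hdet
      exact RatFunc.algebraMap_ne_zero hP hdet.symm
    · intro s hs v hv
      by_contra hv0
      obtain ⟨hD, hD0⟩ := det_eval_eq_zero (A := W.submatrix e id)
        (fun i j => hW s hs.le _ _) hv0 (by ext i; exact congrFun hv (e i))
      have := congrArg (val s) hdet
      rw [val_mul hD (reg_algebraMap s Q), hD0, zero_mul, val_algebraMap] at this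
      rw [Multiset.countP_eq_zero] at hn
      exact hn s ((Polynomial.mem_roots hP).mpr this.symm) hs
  | succ n ih =>
    intro W P Q hΦ hW hP hdet hn
    -- The minor may vanish where `W` itself is injective, so `W` can be outer while the count is
    -- still positive.
    by_cases hinj : ∀ s : ℂ, ‖s‖ < 1 → ∀ v, (mval s W).mulVec v = 0 → v = 0
    · refine ⟨W, hΦ, exists_left_inv_of_submatrix_det_ne_zero (e := e) ?_, hW, hinj⟩
      intro h0
      rw [h0, zero_mul] at hdet
      exact RatFunc.algebraMap_ne_zero hP hdet.symm
    push Not at hinj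
    obtain ⟨s, hs, v, hv, hv0⟩ := hinj
    obtain ⟨hD, hD0⟩ := det_eval_eq_zero (A := W.submatrix e id)
      (fun i j => hW s hs.le _ _) hv0 (by ext i; exact congrFun hv (e i))
    have hPs := congrArg (val s) hdet
    rw [val_mul hD (reg_algebraMap s Q), hD0, zero_mul, val_algebraMap] at hPs
    obtain ⟨R, rfl⟩ := Polynomial.dvd_iff_isRoot.mpr hPs.symm
    obtain ⟨B, hBB, hBdet, hB⟩ := exists_zero_removal hs hW hv0 hv
    set d : Polynomial ℂ := 1 - Polynomial.C (starRingEnd ℂ s) * Polynomial.X with hd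
    have hdmap : algebraMap (Polynomial ℂ) (RatFunc ℂ) d = blaschkeDen s := by
      simp [hd, blaschkeDen]
    have hd0 : d ≠ 0 := by
      intro h; rw [h, map_zero] at hdmap; exact blaschkeDen_ne_zero s hdmap.symm
    have hR : R ≠ 0 := right_ne_zero_of_mul hP
    refine ih (W * B) (R * d) Q ?_ hB (mul_ne_zero hR hd0) ?_ ?_
    · rw [Matrix.conjTranspose_mul, Matrix.mul_assoc, ← Matrix.mul_assoc B, hBB, Matrix.one_mul]
      exact hΦ
    · have h1 : (W * B).submatrix e id = W.submatrix e id * B := rfl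
      rw [h1, Matrix.det_mul, hBdet, mul_right_comm, hdet, star_blaschke, map_mul, map_mul, hdmap]
      have := X_sub_C_ne_zero s
      simp only [map_sub, RatFunc.algebraMap_X, RatFunc.algebraMap_C]
      field_simp
    · rw [Polynomial.roots_mul hP, Polynomial.roots_X_sub_C, Multiset.countP_add] at hn
      rw [Polynomial.roots_mul (mul_ne_zero hR hd0), Multiset.countP_add]
      have h0 : d.roots.countP (fun z => ‖z‖ < 1) = 0 := by
        rw [Multiset.countP_eq_zero]
        intro a ha hlt
        refine val_blaschkeDen_ne_zero hs hlt.le (?_ : val a (blaschkeDen s) = 0)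
        rw [← hdmap, val_algebraMap]
        exact (Polynomial.mem_roots hd0).mp ha
      have h1 : ({s} : Multiset ℂ).countP (fun z => ‖z‖ < 1) = 1 := by
        simp [← Multiset.cons_zero, hs]
      omega

theorem exists_outerFactor {Φ : Matrix ι ι (RatFunc ℂ)} (hrank : Φ.rank = m)
    (hreg : ∀ z : ℂ, ‖z‖ = 1 → MReg z Φ) (hpos : ∀ z : ℂ, ‖z‖ = 1 → (mval z Φ).PosSemidef) :
    ∃ W : Matrix ι (Fin m) (RatFunc ℂ), IsOuterFactor Φ W := by
  classical
  obtain ⟨W, hW⟩ := exists_eq_mul_conjTranspose m Φ hrank.le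
    (eventually_circle_norm.mono hpos)
  obtain ⟨q, hq, hWq⟩ := exists_common_denom W
  obtain ⟨g, hgg, hg, hgq⟩ := exists_allPass _ q hq rfl
  have hg0 : g ≠ 0 := left_ne_zero_of_mul_eq_one hgg
  have hWr : W.rank = m := by
    refine le_antisymm (W.rank_le_card_width.trans (Fintype.card_fin m).le) ?_
    have h1 : Φ.rank ≤ W.rank := by
      rw [hW]
      exact Matrix.rank_mul_le_left _ _
    exact hrank.symm.le.trans h1
  obtain ⟨e, he⟩ := exists_submatrix_det_ne_zero W hWr
  have hdet : ((g • W).submatrix e id).det ≠ 0 := by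
    have : (g • W).submatrix e id = g • W.submatrix e id := rfl
    rw [this, Matrix.det_smul]
    exact mul_ne_zero (pow_ne_zero _ hg0) he
  refine exists_outerFactor_of_countP e _ (g • W) ((g • W).submatrix e id).det.num
    ((g • W).submatrix e id).det.denom ?_ (fun s hs => ?_) (RatFunc.num_ne_zero hdet) ?_ rfl
  · rw [Matrix.conjTranspose_smul, Matrix.smul_mul, Matrix.mul_smul, smul_smul, hgg, one_smul, hW]
  -- In the open disc `g` cancels the common denominator; on the circle `W` is already regular
  -- because `Φ = W W*` is.
  · rcases hs.lt_or_eq with hs' | hs'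
    · intro i j
      obtain ⟨p, hp⟩ := hWq i j
      rw [Matrix.smul_apply, smul_eq_mul, hp, mul_div_left_comm]
      exact (reg_algebraMap s p).mul (hgq s hs')
    · exact (mReg_of_mul_conjTranspose hs' (hW ▸ hreg s hs')).smul (hg s hs)
  · generalize ((g • W).submatrix e id).det = D
    have h := RatFunc.num_div_denom D
    rw [div_eq_iff (RatFunc.algebraMap_ne_zero D.denom_ne_zero)] at h
    exact h.symm

end Removal

/-! ### Invariance properties of outer factors -/

section Invariance

variable {ι : Type*} [Fintype ι] {m : ℕ} {Φ : Matrix ι ι (RatFunc ℂ)}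
  {W : Matrix ι (Fin m) (RatFunc ℂ)}

theorem map_C_one : (1 : Matrix (Fin m) (Fin m) ℂ).map RatFunc.C = 1 :=
  Matrix.map_one _ (map_zero _) (map_one _)

theorem IsOuterFactor.mul_unitary (h : IsOuterFactor Φ W) {U : Matrix (Fin m) (Fin m) ℂ}
    (hU : U ∈ Matrix.unitaryGroup (Fin m) ℂ) : IsOuterFactor Φ (W * U.map RatFunc.C) := by
  have h1 : U * U.conjTranspose = 1 := Matrix.mem_unitaryGroup_iff.mp hU
  have h2 : U.conjTranspose * U = 1 := Matrix.mem_unitaryGroup_iff'.mp hU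
  refine ⟨?_, ?_, fun s hs => (h.reg s hs).mul (mReg_map_C s U), fun s hs v hv => ?_⟩
  · rw [Matrix.conjTranspose_mul, Matrix.mul_assoc, ← Matrix.mul_assoc (U.map RatFunc.C),
      map_C_conjTranspose, ← Matrix.map_mul, h1, map_C_one, Matrix.one_mul]
    exact h.eq_mul
  · obtain ⟨L, hL⟩ := h.exists_left_inv
    refine ⟨U.conjTranspose.map RatFunc.C * L, ?_⟩
    rw [Matrix.mul_assoc, ← Matrix.mul_assoc L, hL, Matrix.one_mul, ← Matrix.map_mul, h2, map_C_one]
  · rw [mval_mul (h.reg s hs.le) (mReg_map_C s U), mval_map_C, ← Matrix.mulVec_mulVec] at hv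
    have h3 := congrArg U.conjTranspose.mulVec (h.inj s hs _ hv)
    rwa [Matrix.mulVec_mulVec, h2, Matrix.one_mulVec, Matrix.mulVec_zero] at h3

theorem star_conjHom (f : RatFunc ℂ) : star (conjHom f) = conjHom (star f) := by
  rw [star_eq, star_eq, conjHom_conjHom, conjHom_invHom, conjHom_conjHom]

theorem star_invHom (f : RatFunc ℂ) : star (invHom f) = invHom (star f) := by
  rw [star_eq, star_eq, conjHom_invHom]

theorem conjTranspose_map_conjHom {ι κ : Type*} (A : Matrix ι κ (RatFunc ℂ)) :
    (A.map conjHom).conjTranspose = A.conjTranspose.map conjHom := by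
  ext i j; exact star_conjHom _

theorem conjTranspose_map_invHom {ι κ : Type*} (A : Matrix ι κ (RatFunc ℂ)) :
    (A.map invHom).conjTranspose = A.conjTranspose.map invHom := by
  ext i j; exact star_invHom _

theorem MReg.conjHom_and_mval {ι κ : Type*} {s : ℂ} {A : Matrix ι κ (RatFunc ℂ)} (hA : MReg s A) :
    MReg (starRingEnd ℂ s) (A.map conjHom) ∧
      mval (starRingEnd ℂ s) (A.map conjHom) = (mval s A).map (starRingEnd ℂ) :=
  ⟨fun i j => (hA i j).conjHom_and_val.1, by ext i j; exact (hA i j).conjHom_and_val.2⟩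

/-- Conjugating coefficients reflects points in the real axis, which preserves the disc; a null
vector `v` at `s` becomes the null vector `star v` at the conjugate point. -/
theorem IsOuterFactor.conj (h : IsOuterFactor Φ W) :
    IsOuterFactor (Φ.map conjHom) (W.map conjHom) := by
  refine ⟨?_, ?_, fun s hs => ?_, fun s hs v hv => ?_⟩
  · rw [conjTranspose_map_conjHom, ← Matrix.map_mul, ← h.eq_mul]
  · obtain ⟨L, hL⟩ := h.exists_left_inv
    exact ⟨L.map conjHom, by
      rw [← Matrix.map_mul, hL, Matrix.map_one _ (map_zero _) (map_one _)]⟩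
  · simpa using (h.reg (starRingEnd ℂ s) (by rwa [RCLike.norm_conj])).conjHom_and_mval.1
  · have hs' : ‖starRingEnd ℂ s‖ < 1 := by rwa [RCLike.norm_conj]
    have h1 := (h.reg (starRingEnd ℂ s) hs'.le).conjHom_and_mval.2
    rw [Complex.conj_conj] at h1
    rw [h1] at hv
    have h2 := h.inj _ hs' (star v) (by
      ext i
      have := congrArg (starRingEnd ℂ) (congrFun hv i)
      simpa [Matrix.mulVec, dotProduct, map_sum] using this)
    simpa using congrArg star h2

end Invariance

/-! ### Real coefficients -/

section Real

/-- Testing on real vectors shows that `P` is positive semidefinite over `ℝ`, where it factors as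
`Bᵀ B`. -/
theorem exists_real_factor {m : ℕ} {P : Matrix (Fin m) (Fin m) ℂ} (hP : P.PosSemidef)
    (hreal : P.map (starRingEnd ℂ) = P) :
    ∃ S : Matrix (Fin m) (Fin m) ℂ, S.map (starRingEnd ℂ) = S ∧ P = S * S.conjTranspose := by
  set R : Matrix (Fin m) (Fin m) ℝ := P.map Complex.re with hR
  have hPR : P = R.map Complex.ofReal := by
    ext i j
    exact (Complex.conj_eq_iff_re.mp (congrFun (congrFun hreal i) j)).symm
  have hRpos : R.PosSemidef := by
    refine Matrix.PosSemidef.of_dotProduct_mulVec_nonneg ?_ fun x => ?_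
    · ext i j
      have := congrArg Complex.re (congrFun (congrFun hP.isHermitian i) j)
      simpa [hR] using this
    · have h := hP.dotProduct_mulVec_nonneg (fun i => (x i : ℂ))
      have e : star (fun i => (x i : ℂ)) ⬝ᵥ P.mulVec (fun i => (x i : ℂ)) =
          ((star x ⬝ᵥ R.mulVec x : ℝ) : ℂ) := by
        rw [hPR]
        simp [dotProduct, Matrix.mulVec]
      rw [e] at h
      exact_mod_cast h
  obtain ⟨B, hB⟩ : ∃ B : Matrix (Fin m) (Fin m) ℝ, R = B.conjTranspose * B := by
    open scoped MatrixOrder in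
    exact CStarAlgebra.nonneg_iff_eq_star_mul_self.mp hRpos.nonneg
  refine ⟨B.conjTranspose.map Complex.ofReal, by ext i j; simp, ?_⟩
  rw [hPR, hB]
  ext i j
  simp [Matrix.mul_apply]

/-- If the density has real coefficients then some outer factor has real coefficients. -/
theorem IsOuterFactor.exists_real {ι : Type*} [Fintype ι] {m : ℕ} {Φ : Matrix ι ι (RatFunc ℂ)}
    {W : Matrix ι (Fin m) (RatFunc ℂ)} (h : IsOuterFactor Φ W) (hΦ : Φ.map conjHom = Φ) :
    ∃ W' : Matrix ι (Fin m) (RatFunc ℂ), IsOuterFactor Φ W' ∧ W'.map conjHom = W' := by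
  have hconj : ∀ {V : Matrix ι (Fin m) (RatFunc ℂ)}, IsOuterFactor Φ V →
      ∃ U ∈ Matrix.unitaryGroup (Fin m) ℂ, V.map conjHom = V * U.map RatFunc.C ∧
        (mval 0 V).map (starRingEnd ℂ) = mval 0 V * U := by
    intro V hV
    obtain ⟨U, hU, hUV⟩ := hV.unique (hΦ ▸ hV.conj)
    refine ⟨U, hU, hUV, ?_⟩
    have h0 := hV.reg 0 (by simp)
    have h1 := h0.conjHom_and_mval.2
    rw [map_zero, hUV, mval_mul h0 (mReg_map_C 0 U), mval_map_C] at h1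
    exact h1.symm
  obtain ⟨U, hU, -, hU0⟩ := hconj h
  have hrank : (mval 0 W).rank = m := by
    have hinj : Function.Injective (mval 0 W).mulVecLin := by
      rw [← LinearMap.ker_eq_bot, LinearMap.ker_eq_bot']
      exact fun v hv => h.inj 0 (by simp) v hv
    rw [Matrix.rank, LinearMap.finrank_range_of_inj hinj]
    simp
  obtain ⟨e, he⟩ := exists_submatrix_det_ne_zero _ hrank
  set M := (mval 0 W).submatrix e id with hM
  have hMU : M.map (starRingEnd ℂ) = M * U := by
    ext i j
    exact congrFun (congrFun hU0 (e i)) j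
  have hUU : U * U.conjTranspose = 1 := Matrix.mem_unitaryGroup_iff.mp hU
  -- Conjugation replaces `M` by `M U`, and `U U* = 1` drops out of the product.
  have hPreal : (M * M.conjTranspose).map (starRingEnd ℂ) = M * M.conjTranspose := by
    have h2 : M.conjTranspose.map (starRingEnd ℂ) = U.conjTranspose * M.conjTranspose := by
      rw [← Matrix.conjTranspose_mul, ← hMU]
      ext i j; simp
    rw [Matrix.map_mul, h2, hMU, Matrix.mul_assoc, ← Matrix.mul_assoc U, hUU, Matrix.one_mul]
  obtain ⟨S, hS, hSS⟩ := exists_real_factor (Matrix.posSemidef_self_mul_conjTranspose M) hPreal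
  have hSdet : IsUnit S.det := by
    rw [isUnit_iff_ne_zero]
    intro h0
    have := congrArg Matrix.det hSS
    rw [Matrix.det_mul, Matrix.det_mul, Matrix.det_conjTranspose, h0, zero_mul] at this
    exact mul_ne_zero he (star_ne_zero.mpr he) this
  have hS1 : S⁻¹ * S = 1 := Matrix.nonsing_inv_mul _ hSdet
  have hS2 : S.conjTranspose * S⁻¹.conjTranspose = 1 := by
    rw [← Matrix.conjTranspose_mul, hS1, Matrix.conjTranspose_one]
  -- From `M M* = S S*`, the matrix `S⁻¹ M` is unitary, and its adjoint `V` rotates the block `M` to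
  -- the real matrix `S`.
  set V := (S⁻¹ * M).conjTranspose with hV
  have hVU : V ∈ Matrix.unitaryGroup (Fin m) ℂ := by
    rw [Matrix.mem_unitaryGroup_iff', Matrix.star_eq_conjTranspose, hV,
      Matrix.conjTranspose_conjTranspose, Matrix.conjTranspose_mul, Matrix.mul_assoc,
      ← Matrix.mul_assoc M, hSS, Matrix.mul_assoc S, hS2, Matrix.mul_one, hS1]
  have hMV : M * V = S := by
    rw [hV, Matrix.conjTranspose_mul, ← Matrix.mul_assoc, hSS, Matrix.mul_assoc, hS2,
      Matrix.mul_one]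
  have hW' := h.mul_unitary hVU
  refine ⟨_, hW', ?_⟩
  obtain ⟨U', -, hU', hU0'⟩ := hconj hW'
  rw [mval_mul (h.reg 0 (by simp)) (mReg_map_C 0 V), mval_map_C] at hU0'
  have h3 : S.map (starRingEnd ℂ) = S * U' := by
    rw [← hMV]
    ext i j
    -- Since `S` is real and invertible, `S = S U'` will force `U' = 1`.
    exact congrFun (congrFun hU0' (e i)) j
  have h4 : U' = 1 := by
    rw [hS] at h3
    calc U' = S⁻¹ * S * U' := by rw [hS1, Matrix.one_mul]
      _ = 1 := by rw [Matrix.mul_assoc, ← h3, hS1]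
  rw [hU', h4, map_C_one, Matrix.mul_one]

theorem exists_map_ofReal {p : Polynomial ℂ} (hp : p.map (starRingEnd ℂ) = p) :
    ∃ P : Polynomial ℝ, P.map Complex.ofRealHom = p := by
  have : p ∈ Polynomial.lifts Complex.ofRealHom := by
    rw [Polynomial.lifts_iff_coeff_lifts]
    intro n
    have h1 := congrArg (fun q => Polynomial.coeff q n) hp
    simp only [Polynomial.coeff_map] at h1
    exact ⟨(p.coeff n).re, Complex.conj_eq_iff_re.mp h1⟩
  exact (Polynomial.mem_lifts _).mp this

theorem hasRealCoeffs_iff (f : RatFunc ℂ) : HasRealCoeffs f ↔ conjHom f = f := by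
  constructor
  · rintro ⟨P, Q, -, rfl⟩
    have h : ∀ P : Polynomial ℝ, (P.map Complex.ofRealHom).map (starRingEnd ℂ) =
        P.map Complex.ofRealHom := fun P => by
      ext n; simp
    rw [map_div₀, conjHom_algebraMap, conjHom_algebraMap, h, h]
  · intro hf
    set q := f.denom with hq
    have hq0 : q ≠ 0 := f.denom_ne_zero
    have hqc : q.map (starRingEnd ℂ) ≠ 0 := by simpa [Polynomial.map_eq_zero] using hq0
    have hcc : ∀ r : Polynomial ℂ, (r.map (starRingEnd ℂ)).map (starRingEnd ℂ) = r := fun r => by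
      ext n; simp
    have hq0' := RatFunc.algebraMap_ne_zero (K := ℂ) hq0
    have hqc' := RatFunc.algebraMap_ne_zero (K := ℂ) hqc
    -- Expanding the fraction by the conjugate of `q` makes the denominator self-conjugate; as `f`
    -- is self-conjugate, so is the numerator.
    have hfe : f = algebraMap (Polynomial ℂ) (RatFunc ℂ) (f.num * q.map (starRingEnd ℂ)) /
        algebraMap (Polynomial ℂ) (RatFunc ℂ) (q * q.map (starRingEnd ℂ)) := by
      conv_lhs => rw [← RatFunc.num_div_denom f, ← hq]
      rw [map_mul, map_mul]
      field_simp
    obtain ⟨Q, hQ⟩ := exists_map_ofReal (p := q * q.map (starRingEnd ℂ)) (by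
      rw [Polynomial.map_mul, hcc, mul_comm])
    obtain ⟨P, hP⟩ := exists_map_ofReal (p := f.num * q.map (starRingEnd ℂ)) (by
      apply RatFunc.algebraMap_injective ℂ
      have h1 : algebraMap (Polynomial ℂ) (RatFunc ℂ) (f.num * q.map (starRingEnd ℂ)) =
          f * algebraMap (Polynomial ℂ) (RatFunc ℂ) (q * q.map (starRingEnd ℂ)) := by
        rw [eq_div_iff (by rw [map_mul]; exact mul_ne_zero hq0' hqc')] at hfe
        exact hfe.symm
      rw [← conjHom_algebraMap, h1, map_mul, hf, conjHom_algebraMap, Polynomial.map_mul, hcc,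
        mul_comm q])
    refine ⟨P, Q, ?_, by rw [hP, hQ]; exact hfe⟩
    rintro rfl
    rw [Polynomial.map_zero] at hQ
    exact mul_ne_zero hq0 hqc hQ.symm

end Real

/-! ### Transfer from the exterior of the unit disc to its interior -/

section Transfer

/-- The point of the Riemann sphere with local coordinate `t = 1/z`. -/
def invPoint (t : ℂ) : OnePoint ℂ := if t = 0 then OnePoint.infty else ((t⁻¹ : ℂ) : OnePoint ℂ)

theorem hasPole_coe {f : RatFunc ℂ} {a : ℂ} : HasPole f (a : OnePoint ℂ) ↔ ¬ Reg a f := by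
  simp [HasPole, Reg]

theorem hasPole_invPoint {f : RatFunc ℂ} {t : ℂ} :
    HasPole f (invPoint t) ↔ ¬ Reg t (invHom f) := by
  by_cases ht : t = 0
  · subst ht
    simp [invPoint, HasPole, Reg, invSubst_eq]
  · rw [invPoint, if_neg ht, hasPole_coe, not_iff_not]
    refine ⟨fun h => ?_, fun h => ?_⟩
    · simpa using (h.invHom_and_val (inv_ne_zero ht)).1
    · simpa using (h.invHom_and_val ht).1

theorem value_invPoint {f : RatFunc ℂ} {t : ℂ} (h : Reg t (invHom f)) :
    value f (invPoint t) = val t (invHom f) := by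
  by_cases ht : t = 0
  · subst ht
    simp [invPoint, value, val, invSubst_eq]
  · rw [invPoint, if_neg ht]
    have := (h.invHom_and_val ht).2
    rw [invHom_invHom] at this
    exact this

variable {ι κ : Type*}

theorem matHasPole_invPoint {W : Matrix ι κ (RatFunc ℂ)} {t : ℂ} :
    MatHasPole W (invPoint t) ↔ ¬ MReg t (W.map invHom) := by
  simp only [MatHasPole, hasPole_invPoint, MReg, Matrix.map_apply]
  push Not
  rfl

theorem matValue_invPoint {W : Matrix ι κ (RatFunc ℂ)} {t : ℂ} (h : MReg t (W.map invHom)) :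
    matValue W (invPoint t) = mval t (W.map invHom) := by
  ext i j
  exact value_invPoint (h i j)

theorem eq_coe_or_eq_invPoint (s : OnePoint ℂ) :
    (∃ a : ℂ, s = (a : OnePoint ℂ) ∧ ‖a‖ < 1) ∨ ∃ t : ℂ, s = invPoint t ∧ ‖t‖ ≤ 1 := by
  induction s using OnePoint.rec with
  | infty => exact Or.inr ⟨0, by simp [invPoint], by simp⟩
  | coe a =>
    rcases lt_or_ge ‖a‖ 1 with h | h
    · exact Or.inl ⟨a, rfl, h⟩
    · have ha : a ≠ 0 := by rintro rfl; simp at h; linarith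
      exact Or.inr ⟨a⁻¹, by simp [invPoint, ha], by rw [norm_inv]; exact inv_le_one_of_one_le₀ h⟩

theorem norm_mul_norm_of_invPoint_eq {t a : ℂ} (h : invPoint t = (a : OnePoint ℂ)) :
    ‖t‖ * ‖a‖ = 1 := by
  by_cases ht : t = 0
  · simp [invPoint, ht] at h
  · rw [invPoint, if_neg ht, OnePoint.coe_eq_coe] at h
    rw [← h, norm_inv, mul_inv_cancel₀ (norm_ne_zero_iff.mpr ht)]

/-- The points forbidden for poles are `1/t` with `‖t‖ ≤ 1`, including infinity at `t = 0`; those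
forbidden for zeros are `1/t` with `‖t‖ < 1`. -/
theorem isMinimumPhase_iff [Fintype κ] {W : Matrix ι κ (RatFunc ℂ)} : IsMinimumPhase W ↔
    (∀ s : ℂ, ‖s‖ ≤ 1 → MReg s (W.map invHom)) ∧
      ∀ s : ℂ, ‖s‖ < 1 → ∀ v, (mval s (W.map invHom)).mulVec v = 0 → v = 0 := by
  constructor
  · rintro ⟨hp, hz⟩
    have hreg : ∀ s : ℂ, ‖s‖ ≤ 1 → MReg s (W.map invHom) := by
      intro s hs
      by_contra hns
      obtain ⟨a, ha, ha1⟩ := hp _ (matHasPole_invPoint.mpr hns)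
      nlinarith [norm_mul_norm_of_invPoint_eq ha, norm_nonneg s, norm_nonneg a]
    refine ⟨hreg, fun s hs v hv => ?_⟩
    by_contra hv0
    obtain ⟨a, ha, ha1⟩ := hz (invPoint s) ⟨by
      rw [matHasPole_invPoint, not_not]; exact hreg s hs.le, v, hv0, by
      rw [matValue_invPoint (hreg s hs.le)]; exact hv⟩
    nlinarith [norm_mul_norm_of_invPoint_eq ha, norm_nonneg s, norm_nonneg a]
  · rintro ⟨hreg, hinj⟩
    refine ⟨fun s hs => ?_, fun s hs => ?_⟩
    · rcases eq_coe_or_eq_invPoint s with h | ⟨t, rfl, ht⟩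
      · exact h
      · exact absurd (hreg t ht) (matHasPole_invPoint.mp hs)
    · rcases eq_coe_or_eq_invPoint s with ⟨a, ha, ha1⟩ | ⟨t, rfl, ht⟩
      · exact ⟨a, ha, ha1.le⟩
      · rcases ht.lt_or_eq with ht' | ht'
        · obtain ⟨-, v, hv0, hv⟩ := hs
          rw [matValue_invPoint (hreg t ht)] at hv
          exact absurd (hinj t ht' v hv) hv0
        · refine ⟨t⁻¹, ?_, by rw [norm_inv, ht', inv_one]⟩
          rw [invPoint, if_neg (ne_zero_of_norm_eq_one ht')]

theorem map_invHom_map_invHom (A : Matrix ι κ (RatFunc ℂ)) : (A.map invHom).map invHom = A := by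
  ext i j; simp

/-- A factorization through as many rows as the rank survives `φ`. For the involution `invHom`,
applying this twice gives equality. -/
theorem rank_map_le {K L ι κ : Type*} [Field K] [Field L] [Fintype ι] [Fintype κ] (φ : K →+* L)
    (A : Matrix ι κ K) : (A.map φ).rank ≤ A.rank := by
  obtain ⟨f, -, hspan, -⟩ := Submodule.exists_fun_fin_finrank_span_eq K (Set.range A.row)
  have hrow : ∀ i, ∃ c : Fin _ → K, ∑ k, c k • f k = A.row i := fun i => by
    rw [← Submodule.mem_span_range_iff_exists_fun, hspan]
    exact Submodule.subset_span ⟨i, rfl⟩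
  choose c hc using hrow
  have hA : A = Matrix.of c * Matrix.of f := by
    ext i j
    have := congrFun (hc i) j
    simpa [Matrix.mul_apply] using this.symm
  have h1 : (A.map φ).rank ≤ ((Matrix.of c).map φ).rank := by
    have h2 := congrArg (fun B => B.map φ) hA
    simp only [Matrix.map_mul] at h2
    rw [h2]
    exact Matrix.rank_mul_le_left _ _
  refine h1.trans ((Matrix.rank_le_card_width _).trans ?_)
  rw [Fintype.card_fin, A.rank_eq_finrank_span_row]

theorem rank_map_invHom [Fintype ι] [Fintype κ] (A : Matrix ι κ (RatFunc ℂ)) :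
    (A.map invHom).rank = A.rank := by
  refine le_antisymm (rank_map_le _ _) ?_
  conv_lhs => rw [← map_invHom_map_invHom A]
  exact rank_map_le _ _

theorem isMinPhaseFactor_iff [Fintype ι] {m : ℕ} {Φ : Matrix ι ι (RatFunc ℂ)}
    {W : Matrix ι (Fin m) (RatFunc ℂ)} :
    IsMinPhaseFactor Φ W ↔ IsOuterFactor (Φ.map invHom) (W.map invHom) := by
  have hmap : ∀ A B : Matrix ι ι (RatFunc ℂ), A = B ↔ A.map invHom = B.map invHom := fun A B =>
    ⟨fun h => by rw [h], fun h => by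
      rw [← map_invHom_map_invHom A, h, map_invHom_map_invHom]⟩
  have hmul : Φ = W * matParaConj W ↔
      Φ.map invHom = W.map invHom * (W.map invHom).conjTranspose := by
    rw [hmap, matParaConj_eq, Matrix.map_mul, conjTranspose_map_invHom]
  rw [IsMinPhaseFactor, isMinimumPhase_iff, hmul, Fintype.card_fin]
  constructor
  · rintro ⟨h1, h2, h3, h4⟩
    refine ⟨h2, ?_, h3, h4⟩
    obtain ⟨e, he⟩ := exists_submatrix_det_ne_zero (W.map invHom) (by rw [rank_map_invHom, h1])
    exact exists_left_inv_of_submatrix_det_ne_zero he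
  · rintro ⟨h1, ⟨L, hL⟩, h2, h3⟩
    refine ⟨le_antisymm (W.rank_le_card_width.trans (Fintype.card_fin m).le) ?_, h1, h2, h3⟩
    rw [← rank_map_invHom]
    have := Matrix.rank_mul_le_right L (W.map invHom)
    rwa [hL, Matrix.rank_one, Fintype.card_fin] at this

theorem IsSpectralDensity.map_invHom {Φ : Matrix ι ι (RatFunc ℂ)} (h : IsSpectralDensity Φ) {z : ℂ}
    (hz : ‖z‖ = 1) : MReg z (Φ.map invHom) ∧ (mval z (Φ.map invHom)).PosSemidef := by
  have hz0 := ne_zero_of_norm_eq_one hz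
  have h1 := h z⁻¹ (by rw [norm_inv, hz, inv_one])
  have e : ((z⁻¹ : ℂ) : OnePoint ℂ) = invPoint z := by rw [invPoint, if_neg hz0]
  rw [e, matHasPole_invPoint, not_not] at h1
  refine ⟨h1.1, ?_⟩
  rw [← matValue_invPoint h1.1]
  exact h1.2

theorem map_map_C_invHom (U : Matrix ι κ ℂ) : (U.map RatFunc.C).map invHom = U.map RatFunc.C := by
  ext i j; simp

end Transfer

end RatSpec

end

theorem lemma2p2 (m p : ℕ) (hm : 0 < m)
    (Φ : Matrix (Fin (m + p)) (Fin (m + p)) (RatFunc ℂ))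
    (hΦ : RatSpec.IsSpectralDensity Φ) (hrank : Φ.rank = m) :
    -- existence
    (∃ W : Matrix (Fin (m + p)) (Fin m) (RatFunc ℂ), RatSpec.IsMinPhaseFactor Φ W) ∧
    -- the factors are exactly the right multiples of any one of them by constant unitary matrices
    (∀ W : Matrix (Fin (m + p)) (Fin m) (RatFunc ℂ), RatSpec.IsMinPhaseFactor Φ W →
      ∀ W' : Matrix (Fin (m + p)) (Fin m) (RatFunc ℂ), RatSpec.IsMinPhaseFactor Φ W' ↔
        ∃ U ∈ Matrix.unitaryGroup (Fin m) ℂ, W' = W * U.map RatFunc.C) ∧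
    -- if the density has real coefficients, then the factor can be chosen with real coefficients
    ((∀ i j, RatSpec.HasRealCoeffs (Φ i j)) →
      ∃ W : Matrix (Fin (m + p)) (Fin m) (RatFunc ℂ), RatSpec.IsMinPhaseFactor Φ W ∧
        ∀ i j, RatSpec.HasRealCoeffs (W i j)) := by
  -- `V` is an outer factor of `Φ(1/z)`; substituting `1/z` back gives the minimum-phase factor of
  -- `Φ`. Constant matrices are unaffected by the substitution.
  obtain ⟨V, hV⟩ := RatSpec.exists_outerFactor ((RatSpec.rank_map_invHom Φ).trans hrank)
    (fun z hz => (hΦ.map_invHom hz).1) (fun z hz => (hΦ.map_invHom hz).2)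
  refine ⟨⟨V.map RatSpec.invHom, ?_⟩, fun W hW W' => ⟨fun hW' => ?_, ?_⟩, fun hreal => ?_⟩
  · rwa [RatSpec.isMinPhaseFactor_iff, RatSpec.map_invHom_map_invHom]
  · obtain ⟨U, hU, hUW⟩ := (RatSpec.isMinPhaseFactor_iff.mp hW).unique
      (RatSpec.isMinPhaseFactor_iff.mp hW')
    refine ⟨U, hU, ?_⟩
    rw [← RatSpec.map_invHom_map_invHom W', hUW, Matrix.map_mul, RatSpec.map_invHom_map_invHom,
      RatSpec.map_map_C_invHom]
  · rintro ⟨U, hU, rfl⟩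
    rw [RatSpec.isMinPhaseFactor_iff] at hW ⊢
    rw [Matrix.map_mul, RatSpec.map_map_C_invHom]
    exact hW.mul_unitary hU
  · obtain ⟨W, hW, hWreal⟩ := hV.exists_real (by
      ext i j
      simp only [Matrix.map_apply]
      rw [RatSpec.conjHom_invHom, (RatSpec.hasRealCoeffs_iff _).mp (hreal i j)])
    refine ⟨W.map RatSpec.invHom, ?_, fun i j => ?_⟩
    · rwa [RatSpec.isMinPhaseFactor_iff, RatSpec.map_invHom_map_invHom]
    · rw [RatSpec.hasRealCoeffs_iff, Matrix.map_apply, RatSpec.conjHom_invHom]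
      exact congrArg RatSpec.invHom (congrFun (congrFun hWreal i) j)
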